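/- **Theorem 4.1.** Let $V$ be a finite set. An ice quiver $Q$ on $V$ (a quiver without loops or directed 2-cycles, some of whose vertices are declared frozen, the others being mutable) is encoded by the skew-symmetric integer matrix $Q_{ij}=\#(i\to j)-\#(j\to i)$. It is acyclic if there is no directed cycle of mutable vertices. A seed $(Q,\mathbf a)$ consists of an ice quiver $Q$ on $V$ and a cluster $\mathbf a=(a_v)_{v\in V}$ of elements of $\mathbb{Q}(x_v : v\in V)$. Its mutation at a mutable vertex $k$ leaves the frozen vertices and the $a_i$ with $i\ne k$ unchanged, replaces $Q_{ij}$ by $-Q_{ij}$ if $k\in\{i,j\}$ and by $Q_{ij}+\tfrac12\left(|Q_{ik}|Q_{kj}+Q_{ik}|Q_{kj}|\right)$ otherwise, and replaces $a_k$ by $$\Big(\prod_{j:\,Q_{kj}>0}a_j^{Q_{kj}}+\prod_{j:\,Q_{kj}<0}a_j^{-Q_{kj}}\Big)a_k^{-1}.$$ Fix a seed $(Q,\mathbf a)$ whose cluster is algebraically independent over $\mathbb{Q}$ (for example $\mathbf a=(x_v)_{v\in V}$). The seeds of $(Q,\mathbf a)$ are the seeds obtained from it by finite sequences of mutations at mutable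 vertices. The cluster algebra $\mathcal A$ of $(Q,\mathbf a)$ is the subring of $\mathbb{Q}(x_v : v\in V)$ generated by the entries of the clusters of all its seeds (the cluster variables) and by the inverses $a_v^{-1}$ with $v$ frozen. Its upper cluster algebra is $$\mathcal U=\bigcap_{\text{seeds }(R,\mathbf b)\text{ of }(Q,\mathbf a)}\mathbb{Z}[b_v^{\pm1}: v\in V].$$ A cluster algebra is acyclic if one of its seeds has an acyclic quiver. An acyclic cluster chart of $\operatorname{Spec}\mathcal A$ is obtained as follows: take a seed $(R,\mathbf b)$ of $(Q,\mathbf a)$ and a set $F$ of mutable vertices, declare the vertices in $F$ frozen too, and let $\mathcal A'$ be the cluster algebra of the resulting seed; if $\mathcal A'$ is acyclic and $\mathcal A\subseteq\mathcal A'$, the image of $\operatorname{Spec}\mathcal A'\to\operatorname{Spec}\mathcal A$ is an acyclic cluster chart. Call $\mathcal A$ locally acyclic if $\operatorname{Spec}\mathcal A$ is the union of finitely many acyclic cluster charts. If $\mathcal A$ is locally acyclic, then $\mathcal A=\mathcal U$. -/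

import Mathlib

namespace ClusterAlg

/-- An ice quiver on the vertex set `V`, without loops or directed 2-cycles. It is recorded by its
skew-symmetric integer matrix `Q i j = #(arrows i → j) - #(arrows j → i)`, together with the set
of frozen vertices. -/
@[ext] structure IceQuiver (V : Type*) where
  /-- signed number of arrows from `i` to `j` -/
  Q : V → V → ℤ
  skew : ∀ i j, Q i j = - Q j i
  /-- the frozen vertices; the other vertices are mutable -/
  frozen : Set V

namespace IceQuiver

variable {V : Type*}

/-- There is an arrow `i → j` of the induced subquiver on the mutable vertices. -/
def MutArrow (q : IceQuiver V) (i j : V) : Prop :=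
  i ∉ q.frozen ∧ j ∉ q.frozen ∧ 0 < q.Q i j

/-- The induced subquiver on the mutable vertices has no directed cycle. -/
def IsAcyclic (q : IceQuiver V) : Prop :=
  ∀ i, ¬ Relation.TransGen q.MutArrow i i

/-- The correction term of quiver mutation changes sign when the two arrows are reversed. -/
theorem mutation_term_neg (a b : ℤ) :
    (|a| * b + a * |b|) / 2 = - ((|-b| * (-a) + (-b) * |-a|) / 2) := by
  have h : ∃ c : ℤ, |a| * b + a * |b| = 2 * c := by
    rcases abs_choice a with ha | ha <;> rcases abs_choice b with hb | hb <;> rw [ha, hb]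
    · exact ⟨a * b, by ring⟩
    · exact ⟨0, by ring⟩
    · exact ⟨0, by ring⟩
    · exact ⟨-(a * b), by ring⟩
  obtain ⟨c, hc⟩ := h
  have h2 : |-b| * (-a) + (-b) * |-a| = 2 * (-c) := by
    rw [abs_neg, abs_neg]; linarith
  rw [hc, h2]
  omega

/-- Mutation of an ice quiver at the vertex `k`; the frozen vertices stay the same. -/
def mutate [DecidableEq V] (q : IceQuiver V) (k : V) : IceQuiver V where
  Q i j :=
    if i = k ∨ j = k then - q.Q i j
    else q.Q i j + (|q.Q i k| * q.Q k j + q.Q i k * |q.Q k j|) / 2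
  skew i j := by
    by_cases h : i = k ∨ j = k
    · have h' : j = k ∨ i = k := h.symm
      rw [if_pos h, if_pos h', q.skew i j]
    · have h' : ¬ (j = k ∨ i = k) := fun h' => h h'.symm
      rw [if_neg h, if_neg h', mutation_term_neg, q.skew i j, ← q.skew j k, ← q.skew k i]
      ring
  frozen := q.frozen

/-- Declare the vertices in `F` to be frozen as well. -/
def freeze (q : IceQuiver V) (F : Set V) : IceQuiver V where
  Q := q.Q
  skew := q.skew
  frozen := q.frozen ∪ F

end IceQuiver

/-- The field `ℚ(x_v : v ∈ V)` of rational functions. -/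
abbrev RatFun (V : Type*) : Type _ := FractionRing (MvPolynomial V ℚ)

/-- A seed: an ice quiver on `V` and a cluster, that is, a map from the vertices to the field of
rational functions. -/
structure Seed (V : Type*) where
  quiver : IceQuiver V
  cluster : V → RatFun V

namespace Seed

variable {V : Type*}

/-- The freezing of a seed at the vertices in `F`. -/
def freeze (s : Seed V) (F : Set V) : Seed V where
  quiver := s.quiver.freeze F
  cluster := s.cluster

/-- The Laurent ring `ℤ[a_v^{±1} : v ∈ V]` of the cluster of `s`. -/
noncomputable def laurentRing (s : Seed V) : Subalgebra ℤ (RatFun V) :=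
  Algebra.adjoin ℤ (Set.range s.cluster ∪ Set.range fun v => (s.cluster v)⁻¹)

variable [Fintype V] [DecidableEq V]

/-- Mutation of a seed at `k`. In the two products an exponent `Int.toNat e` is `e` if `e > 0` and
`0` otherwise, so the first runs over the `j` with `Q k j > 0` and the second over the `j` with
`Q k j < 0`. -/
noncomputable def mutate (s : Seed V) (k : V) : Seed V where
  quiver := s.quiver.mutate k
  cluster := Function.update s.cluster k
    ((∏ j, s.cluster j ^ (s.quiver.Q k j).toNat + ∏ j, s.cluster j ^ (-s.quiver.Q k j).toNat) *
      (s.cluster k)⁻¹)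

/-- `t` is obtained from `s` by one mutation at a mutable vertex. -/
def MutStep (s t : Seed V) : Prop :=
  ∃ k, k ∉ s.quiver.frozen ∧ t = s.mutate k

/-- `t` is obtained from `s` by a finite sequence of mutations at mutable vertices. -/
def MutEquiv (s t : Seed V) : Prop :=
  Relation.ReflTransGen MutStep s t

/-- The cluster variables (mutable and frozen) of the cluster algebra of `s`. -/
def clusterVariables (s : Seed V) : Set (RatFun V) :=
  {x | ∃ t, s.MutEquiv t ∧ ∃ v, x = t.cluster v}

/-- The cluster algebra `A(s)`: the subring of the field of rational functions generated by all
cluster variables and by the inverses of the frozen variables. -/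
noncomputable def clusterAlgebra (s : Seed V) : Subalgebra ℤ (RatFun V) :=
  Algebra.adjoin ℤ (s.clusterVariables ∪ (fun v => (s.cluster v)⁻¹) '' s.quiver.frozen)

/-- The upper cluster algebra `U(s)`: the intersection of the Laurent rings of all clusters. -/
noncomputable def upperClusterAlgebra (s : Seed V) : Subalgebra ℤ (RatFun V) :=
  ⨅ (t : Seed V) (_ : s.MutEquiv t), t.laurentRing

/-- The cluster algebra of `s` is acyclic: it has an acyclic seed. -/
def IsAcyclic (s : Seed V) : Prop :=
  ∃ t, s.MutEquiv t ∧ t.quiver.IsAcyclic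

/-- `U` is an acyclic cluster chart of `Spec A(s)`: for some seed `t` of `A(s)` and some set `F` of
mutable vertices of `t`, the freezing `A'` of `A(s)` at the cluster variables `F` of `t` is a
cluster localization (`A(s) ⊆ A'`), `A'` is acyclic, and `U` is the image of
`Spec A' → Spec A(s)`. -/
def IsAcyclicClusterChart (s : Seed V) (U : Set (PrimeSpectrum s.clusterAlgebra)) : Prop :=
  ∃ (t : Seed V) (F : Set V), s.MutEquiv t ∧ Disjoint F t.quiver.frozen ∧
    (t.freeze F).IsAcyclic ∧
    ∃ h : s.clusterAlgebra ≤ (t.freeze F).clusterAlgebra,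
      U = Set.range (PrimeSpectrum.comap (Subalgebra.inclusion h).toRingHom)

/-- The cluster algebra of `s` is locally acyclic: its spectrum has a finite cover by acyclic
cluster charts. -/
def IsLocallyAcyclic (s : Seed V) : Prop :=
  ∃ C : Set (Set (PrimeSpectrum s.clusterAlgebra)), C.Finite ∧
    (∀ U ∈ C, s.IsAcyclicClusterChart U) ∧ ⋃₀ C = Set.univ

end Seed

end ClusterAlg

/-!
# Locally acyclic cluster algebras are equal to their upper cluster algebras

The inclusion `A ⊆ U` is the Laurent phenomenon. It is proved for seeds in an arbitrary field, by
induction on the length of a sequence of mutations. Let it begin with mutations at `k` and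
`j ≠ k`, and let `c` be the seed reached by these two. By induction, a cluster variable at the end
of the sequence is a Laurent polynomial in the cluster of `c` and in those of its neighbours in the
directions `j` and `k`, and the initial seed is the mutation of `c` at `j` and then at `k`.
So it suffices to compare the four Laurent rings.
* If there are arrows between `j` and `k`, the variables `a_j` and `a_k` generate the unit ideal in
  the ring generated by `a_j, a_j', a_k, a_k'` and the Laurent polynomials in the other variables;
  hence the intersection of the three Laurent rings is contained in this ring, which in turn is
  contained in the fourth Laurent ring (`mem_laurentOn_of_ne_zero`).
* If there are none, the claim holds as soon as the two exchange polynomials are coprime. This is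
  forced by a new vertex that is joined to one of `j` and `k` only
  (`mem_laurentOn_of_eq_zero`), and the variable of the new vertex is specialized to `1` afterwards
  (`Specializes`).

The inclusion `U ⊆ A` holds for acyclic seeds by induction on the number of mutable vertices
(`FieldSeed.upperClusterAlgebra_le_of_isAcyclic`). If there are arrows between mutable vertices, a
source `i` of the mutable part and an arrow `i → j` give two variables that generate the unit ideal
of `A`, since one of the two monomials in the exchange relation at `i` is a unit; freezing `i` or `j`
enlarges `U`, replaces `A` by a ring contained in its localization at `a_i` or `a_j`, and leaves an
acyclic seed with fewer mutable vertices. If there are no such arrows,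
an element of `U` is a Laurent polynomial both in `a_k` and in `a_k'` over a ring in which
`a_k a_k'` lies, and hence a polynomial in these two (`mem_adjoin_of_mem_adjoin_inv`).

In the locally acyclic case, the denominators in `A` of an element of `U` form an ideal. On an
acyclic chart it contains a power of the product of the newly frozen variables, which is a unit on
the chart. Since the charts cover the spectrum, this ideal is contained in no maximal ideal, and so
it contains `1`.
-/

/-! ### Subalgebras of a field and Laurent polynomials -/

namespace ClusterAlg

open Polynomial

section Subalgebras

variable {K : Type*} [Field K]

/-- Whether the elements of a ring lie in the localization of `E` at `y` is checked on
generators. -/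
theorem exists_pow_mul_mem_of_mem_adjoin {E : Subalgebra ℤ K} {T : Set K} {y u : K} (hy : y ∈ E)
    (hT : ∀ t ∈ T, ∃ N : ℕ, y ^ N * t ∈ E) (hu : u ∈ Algebra.adjoin ℤ T) :
    ∃ N : ℕ, y ^ N * u ∈ E := by
  induction hu using Algebra.adjoin_induction with
  | mem t ht => exact hT t ht
  | algebraMap r => exact ⟨0, by simp⟩
  | add a b _ _ ha hb =>
    obtain ⟨M, hM⟩ := ha
    obtain ⟨N, hN⟩ := hb
    refine ⟨M + N, ?_⟩
    have h := add_mem (mul_mem (pow_mem hy N) hM) (mul_mem (pow_mem hy M) hN)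
    convert h using 1
    ring
  | mul a b _ _ ha hb =>
    obtain ⟨M, hM⟩ := ha
    obtain ⟨N, hN⟩ := hb
    refine ⟨M + N, ?_⟩
    convert mul_mem hM hN using 1
    ring

/-- An element that lies in `E` locally on the two basic opens of a comaximal pair lies in `E`. -/
theorem mem_of_pow_mul_mem_of_add_eq_one {E : Subalgebra ℤ K} {x y r s u : K} (hx : x ∈ E)
    (hy : y ∈ E) (hr : r ∈ E) (hs : s ∈ E) (h : r * x + s * y = 1)
    (hxu : ∃ N : ℕ, x ^ N * u ∈ E) (hyu : ∃ N : ℕ, y ^ N * u ∈ E) : u ∈ E := by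
  obtain ⟨M, hM⟩ := hxu
  obtain ⟨N, hN⟩ := hyu
  have hc : IsCoprime (⟨x, hx⟩ : E) ⟨y, hy⟩ := ⟨⟨r, hr⟩, ⟨s, hs⟩, Subtype.ext h⟩
  obtain ⟨a, b, hab⟩ := hc.pow (m := M) (n := N)
  have hab' : (a : K) * x ^ M + b * y ^ N = 1 := congrArg Subtype.val hab
  have : u = a * (x ^ M * u) + b * (y ^ N * u) := by linear_combination (-u) * hab'
  rw [this]
  exact add_mem (mul_mem a.2 hM) (mul_mem b.2 hN)

theorem aeval_mem_of_mem {C E : Subalgebra ℤ K} (hCE : C ≤ E) {x : K} (hx : x ∈ E) (f : C[X]) :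
    aeval x f ∈ E := by
  rw [aeval_eq_sum_range]
  exact sum_mem fun i _ => by
    rw [Algebra.smul_def]
    exact mul_mem (hCE (f.coeff i).2) (pow_mem hx i)

/-- The elements of `C[x, x⁻¹]` are polynomials in `x` divided by a power of `x`. -/
theorem exists_pow_mul_eq_aeval (C : Subalgebra ℤ K) {x u : K} (hx : x ≠ 0)
    (hu : u ∈ Algebra.adjoin ℤ ((C : Set K) ∪ {x, x⁻¹})) :
    ∃ (N : ℕ) (f : C[X]), x ^ N * u = aeval x f := by
  let E : Subalgebra ℤ K := (aeval (R := C) x).range.restrictScalars ℤ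
  have hxE : x ∈ E := ⟨X, by simp⟩
  obtain ⟨N, f, hf⟩ := exists_pow_mul_mem_of_mem_adjoin (E := E) hxE (fun t ht => by
    rcases ht with ht | rfl | rfl
    · exact ⟨0, Polynomial.C ⟨t, ht⟩, by simp⟩
    · exact ⟨0, by simpa using hxE⟩
    · exact ⟨1, by simp [hx]⟩) hu
  exact ⟨N, f, hf.symm⟩

/-- An element which is a Laurent polynomial both in `x` and in `P / x` is a polynomial in
`x` and `P / x`. -/
theorem mem_adjoin_of_mem_adjoin_inv (C : Subalgebra ℤ K) {x x' P u : K} (hx : Transcendental C x)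
    (hP : P ∈ C) (hP0 : P ≠ 0) (hxx' : x * x' = P)
    (h1 : u ∈ Algebra.adjoin ℤ ((C : Set K) ∪ {x, x⁻¹}))
    (h2 : u ∈ Algebra.adjoin ℤ ((C : Set K) ∪ {x', x'⁻¹})) :
    u ∈ Algebra.adjoin ℤ ((C : Set K) ∪ {x, x'}) := by
  have hx0 : x ≠ 0 := by rintro rfl; simp [hP0.symm] at hxx'
  have hx0' : x' ≠ 0 := by rintro rfl; simp [hP0.symm] at hxx'
  obtain ⟨N, f, hf⟩ := exists_pow_mul_eq_aeval C hx0 h1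
  obtain ⟨M, g, hg⟩ := exists_pow_mul_eq_aeval C hx0' h2
  set p : C := ⟨P, hP⟩ with hp
  have hp0 : p ≠ 0 := fun h => hP0 (congrArg Subtype.val h)
  have hpP : algebraMap C K p = P := rfl
  set J := g.natDegree with hJ
  -- `h` is `x ^ J * g (P / x)`, written as a polynomial in `x`.
  set h : C[X] := ∑ j ∈ Finset.range (J + 1), Polynomial.C (g.coeff j * p ^ j) * X ^ (J - j) with hh
  have hgh : x ^ J * aeval x' g = aeval x h := by
    rw [aeval_eq_sum_range, hh, map_sum, Finset.mul_sum]
    refine Finset.sum_congr rfl fun j hj => ?_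
    have hj' : j ≤ J := Nat.lt_succ_iff.mp (Finset.mem_range.mp hj)
    simp only [map_mul, map_pow, aeval_X, aeval_C, Algebra.smul_def, hpP, ← hxx']
    rw [mul_pow]
    calc x ^ J * (algebraMap C K (g.coeff j) * x' ^ j)
        = (x ^ (J - j) * x ^ j) * (algebraMap C K (g.coeff j) * x' ^ j) := by
          rw [← pow_add, Nat.sub_add_cancel hj']
      _ = _ := by ring
  have hpoly : Polynomial.C (p ^ M) * (X ^ J * f) = X ^ (N + M) * h := by
    refine (transcendental_iff_injective.mp hx) ?_
    simp only [map_mul, map_pow, aeval_X, aeval_C, hpP]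
    rw [← hf, ← hgh, ← hg, ← hxx']
    ring
  have hcoeff : ∀ i < N, f.coeff i = g.coeff (M + (N - i)) * p ^ (N - i) := by
    intro i hi
    have h1 := congrArg (fun q => q.coeff (i + J)) hpoly
    simp only [coeff_C_mul, coeff_X_pow_mul', Nat.le_add_left, if_true, Nat.add_sub_cancel] at h1
    have h2 : p ^ M * (g.coeff (M + (N - i)) * p ^ (N - i)) = p ^ M * f.coeff i := by
      rw [h1]
      split_ifs with hle
      · rw [hh, finsetSum_coeff]
        simp only [coeff_C_mul, coeff_X_pow]
        rw [Finset.sum_eq_single (M + (N - i))]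
        · rw [if_pos (by omega), pow_add]; ring
        · intro b hb hne
          have := Finset.mem_range.mp hb
          rw [if_neg (by omega), mul_zero]
        · intro hb
          have := mt Finset.mem_range.mpr hb
          omega
      · rw [coeff_eq_zero_of_natDegree_lt (by omega)]; simp
    exact (mul_left_cancel₀ (pow_ne_zero _ hp0) h2).symm
  set E := Algebra.adjoin ℤ ((C : Set K) ∪ {x, x'})
  have hCE : ∀ c : C, (c : K) ∈ E := fun c => Algebra.subset_adjoin (Or.inl c.2)
  have hxE : x ∈ E := Algebra.subset_adjoin (Or.inr (Or.inl rfl))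
  have hxE' : x' ∈ E := Algebra.subset_adjoin (Or.inr (Or.inr rfl))
  have hu : u = ∑ i ∈ Finset.range (f.natDegree + 1), (x ^ N)⁻¹ * ((f.coeff i : K) * x ^ i) := by
    rw [← Finset.mul_sum, eq_inv_mul_iff_mul_eq₀ (pow_ne_zero _ hx0), hf, aeval_eq_sum_range]
    rfl
  rw [hu]
  refine sum_mem fun i _ => ?_
  rcases lt_or_ge i N with hi | hi
  · rw [hcoeff i hi]
    have : (x ^ N)⁻¹ * (((g.coeff (M + (N - i)) * p ^ (N - i) : C) : K) * x ^ i)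
        = g.coeff (M + (N - i)) * x' ^ (N - i) := by
      rw [inv_mul_eq_iff_eq_mul₀ (pow_ne_zero _ hx0)]
      push_cast
      rw [show (p : K) = x * x' from hxx'.symm, mul_pow]
      calc (g.coeff (M + (N - i)) : K) * (x ^ (N - i) * x' ^ (N - i)) * x ^ i
          = (x ^ (N - i) * x ^ i) * ((g.coeff (M + (N - i)) : K) * x' ^ (N - i)) := by ring
        _ = _ := by rw [← pow_add, Nat.sub_add_cancel hi.le]
    rw [this]
    exact mul_mem (hCE _) (pow_mem hxE' _)
  · have : (x ^ N)⁻¹ * ((f.coeff i : K) * x ^ i) = f.coeff i * x ^ (i - N) := by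
      rw [inv_mul_eq_iff_eq_mul₀ (pow_ne_zero _ hx0)]
      calc (f.coeff i : K) * x ^ i = f.coeff i * (x ^ N * x ^ (i - N)) := by
            rw [← pow_add, Nat.add_sub_cancel' hi]
        _ = _ := by ring
    rw [this]
    exact mul_mem (hCE _) (pow_mem hxE _)

/-- `1 + m X ^ e` is a nonzerodivisor modulo any constant. -/
theorem C_dvd_of_C_dvd_one_add_mul {R : Type*} [CommRing R] {p m : R} {e : ℕ} (he : e ≠ 0)
    {f : R[X]} (h : Polynomial.C p ∣ (1 + Polynomial.C m * X ^ e) * f) : Polynomial.C p ∣ f := by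
  rw [C_dvd_iff_dvd_coeff] at h ⊢
  intro i
  induction i using Nat.strong_induction_on with
  | _ i ih =>
    have hi := h i
    rw [add_mul, one_mul, coeff_add, mul_assoc, coeff_C_mul, coeff_X_pow_mul'] at hi
    split_ifs at hi with hle
    · exact (dvd_add_left ((ih (i - e) (by omega)).mul_left m)).mp hi
    · simpa using hi

/-- In the Laurent ring `C[z, z⁻¹]`, the elements `p` of `C` and `1 + m z ^ e` form a regular
sequence. -/
theorem exists_eq_mul_of_one_add_mul_pow_mul_eq (C : Subalgebra ℤ K) {z p m f g : K} {e : ℕ}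
    (hz : Transcendental C z) (he : e ≠ 0) (hp : p ∈ C) (hm : m ∈ C)
    (hf : f ∈ Algebra.adjoin ℤ ((C : Set K) ∪ {z, z⁻¹}))
    (hg : g ∈ Algebra.adjoin ℤ ((C : Set K) ∪ {z, z⁻¹}))
    (hfg : (1 + m * z ^ e) * f = p * g) :
    ∃ h ∈ Algebra.adjoin ℤ ((C : Set K) ∪ {z, z⁻¹}), f = p * h := by
  have hz0 : z ≠ 0 := by
    rintro rfl
    exact hz isAlgebraic_zero
  obtain ⟨N, F, hF⟩ := exists_pow_mul_eq_aeval C hz0 hf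
  obtain ⟨M, G, hG⟩ := exists_pow_mul_eq_aeval C hz0 hg
  have key : (1 + Polynomial.C (⟨m, hm⟩ : C) * X ^ e) * (X ^ M * F)
      = Polynomial.C (⟨p, hp⟩ : C) * (X ^ N * G) := by
    refine (transcendental_iff_injective.mp hz) ?_
    simp only [map_mul, map_pow, aeval_X, aeval_C, map_add, map_one, ← hF, ← hG]
    change (1 + m * z ^ e) * (z ^ M * (z ^ N * f)) = p * (z ^ N * (z ^ M * g))
    linear_combination z ^ M * z ^ N * hfg
  obtain ⟨H, hH⟩ := C_dvd_of_C_dvd_one_add_mul he (Dvd.intro _ key.symm)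
  have hH' : z ^ M * (z ^ N * f) = p * aeval z H := by
    have := congrArg (aeval (R := C) z) hH
    simp only [map_mul, map_pow, aeval_X, aeval_C, ← hF] at this
    exact this
  refine ⟨(z⁻¹) ^ (M + N) * aeval z H, mul_mem (pow_mem (Algebra.subset_adjoin ?_) _)
    (aeval_mem_of_mem (fun c hc => Algebra.subset_adjoin (Or.inl hc))
      (Algebra.subset_adjoin ?_) H), ?_⟩
  · exact Or.inr (Or.inr rfl)
  · exact Or.inr (Or.inl rfl)
  · rw [inv_pow, mul_left_comm, ← hH', pow_add]
    field_simp

/-- An element `u` of the field with `w ^ N * u` and `p ^ N * u` both in `C[z, z⁻¹]`, where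
`w = 1 + m z ^ e` and `p` and `m` are in `C`, is in `C[z, z⁻¹]`. -/
theorem mem_of_one_add_mul_pow_of_pow_mul_mem (C : Subalgebra ℤ K) {z p m u : K} {e : ℕ}
    (hz : Transcendental C z) (he : e ≠ 0) (hp : p ∈ C) (hm : m ∈ C) (hp0 : p ≠ 0)
    (hw : ∃ N : ℕ, (1 + m * z ^ e) ^ N * u ∈ Algebra.adjoin ℤ ((C : Set K) ∪ {z, z⁻¹}))
    (hpu : ∃ N : ℕ, p ^ N * u ∈ Algebra.adjoin ℤ ((C : Set K) ∪ {z, z⁻¹})) :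
    u ∈ Algebra.adjoin ℤ ((C : Set K) ∪ {z, z⁻¹}) := by
  obtain ⟨M, hM⟩ := hw
  obtain ⟨N, hN⟩ := hpu
  set E := Algebra.adjoin ℤ ((C : Set K) ∪ {z, z⁻¹})
  have hmz : 1 + m * z ^ e ∈ E := add_mem (one_mem _) (mul_mem
    (Algebra.subset_adjoin (Or.inl hm)) (pow_mem (Algebra.subset_adjoin
      (show z ∈ (C : Set K) ∪ {z, z⁻¹} from Or.inr (Or.inl rfl))) _))
  have hpE : p ∈ E := Algebra.subset_adjoin (Or.inl hp)
  -- Cancel one factor of `p` at a time.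
  have step : ∀ v : K, ∀ M : ℕ, (1 + m * z ^ e) ^ M * v ∈ E → p * v ∈ E → v ∈ E := by
    intro v M
    induction M generalizing v with
    | zero => intro h _; simpa using h
    | succ M ih =>
      intro h1 h2
      have hv : (1 + m * z ^ e) * v ∈ E := by
        refine ih _ (by rw [← mul_assoc, ← pow_succ]; exact h1) ?_
        rw [mul_left_comm]
        exact mul_mem hmz h2
      obtain ⟨h, hh, he'⟩ := exists_eq_mul_of_one_add_mul_pow_mul_eq C hz he hp hm h2 hv
        (by ring)
      rwa [mul_left_cancel₀ hp0 he']
  induction N with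
  | zero => simpa using hN
  | succ N ih =>
    refine ih (step _ M ?_ ?_)
    · rw [mul_left_comm]
      exact mul_mem (pow_mem hpE _) hM
    · rw [← mul_assoc, ← pow_succ']
      exact hN

end Subalgebras

end ClusterAlg

/-! ### Mutation of clusters in a field -/

namespace ClusterAlg

section Exchange

variable {V K : Type*}

namespace IceQuiver

theorem Q_self (q : IceQuiver V) (i : V) : q.Q i i = 0 := by
  have := q.skew i i
  omega

/-- The quiver with all arrows reversed. -/
def op (q : IceQuiver V) : IceQuiver V where
  Q i j := - q.Q i j
  skew i j := by rw [q.skew i j]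
  frozen := q.frozen

variable [DecidableEq V]

theorem mutate_Q_left (q : IceQuiver V) (k j : V) : (q.mutate k).Q k j = - q.Q k j :=
  if_pos (Or.inl rfl)

theorem mutate_Q_right (q : IceQuiver V) (i k : V) : (q.mutate k).Q i k = - q.Q i k :=
  if_pos (Or.inr rfl)

theorem mutate_Q_of_ne (q : IceQuiver V) {i j k : V} (hi : i ≠ k) (hj : j ≠ k) :
    (q.mutate k).Q i j = q.Q i j + (|q.Q i k| * q.Q k j + q.Q i k * |q.Q k j|) / 2 :=
  if_neg (not_or.mpr ⟨hi, hj⟩)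

theorem mutate_mutate (q : IceQuiver V) (k : V) : (q.mutate k).mutate k = q := by
  ext i j
  · by_cases hi : i = k
    · subst hi
      rw [mutate_Q_left, mutate_Q_left, neg_neg]
    by_cases hj : j = k
    · subst hj
      rw [mutate_Q_right, mutate_Q_right, neg_neg]
    have h : |-q.Q i k| * -q.Q k j + -q.Q i k * |-q.Q k j|
        = |-q.Q k j| * -q.Q i k + -q.Q k j * |-q.Q i k| := by ring
    rw [mutate_Q_of_ne _ hi hj, mutate_Q_of_ne _ hi hj, mutate_Q_left, mutate_Q_right, h,
      mutation_term_neg (q.Q i k) (q.Q k j)]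
    exact neg_add_cancel_right _ _
  · rfl

theorem op_mutate (q : IceQuiver V) (k : V) : q.op.mutate k = (q.mutate k).op := by
  ext i j
  · by_cases hi : i = k
    · subst hi
      rw [mutate_Q_left]
      exact congrArg Neg.neg (q.mutate_Q_left i j).symm
    by_cases hj : j = k
    · subst hj
      rw [mutate_Q_right]
      exact congrArg Neg.neg (q.mutate_Q_right i j).symm
    rw [mutate_Q_of_ne _ hi hj]
    change - q.Q i j + (|-q.Q i k| * (-q.Q k j) + (-q.Q i k) * |-q.Q k j|) / 2
      = -((q.mutate k).Q i j)
    have h : |-q.Q i k| * -q.Q k j + -q.Q i k * |-q.Q k j|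
        = |-q.Q k j| * -q.Q i k + -q.Q k j * |-q.Q i k| := by ring
    rw [mutate_Q_of_ne _ hi hj, mutation_term_neg (q.Q i k), h, neg_add, neg_neg]
  · rfl

/-- The effect of mutation at `k` on the arrows at `j`, if there are arrows `j → k`. -/
theorem mutate_Q_of_nonneg (q : IceQuiver V) {i j k : V} (hi : i ≠ k) (hj : j ≠ k)
    (h : 0 ≤ q.Q j k) : (q.mutate k).Q j i = q.Q j i + q.Q j k * (q.Q k i).toNat := by
  rw [mutate_Q_of_ne _ hj hi, abs_of_nonneg h]
  congr 1
  rcases le_total 0 (q.Q k i) with h' | h'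
  · rw [abs_of_nonneg h', Int.toNat_of_nonneg h', ← two_mul,
      Int.mul_ediv_cancel_left _ two_ne_zero]
  · rw [abs_of_nonpos h', Int.toNat_of_nonpos h']
    simp

end IceQuiver

variable [Field K]

/-- The Laurent ring `ℤ[a_v^{±1} : v ∈ S]` of a part of a cluster. -/
noncomputable def laurentOn (a : V → K) (S : Set V) : Subalgebra ℤ K :=
  Algebra.adjoin ℤ (a '' S ∪ (fun v => (a v)⁻¹) '' S)

theorem mem_laurentOn (a : V → K) {S : Set V} {v : V} (hv : v ∈ S) : a v ∈ laurentOn a S :=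
  Algebra.subset_adjoin (Or.inl ⟨v, hv, rfl⟩)

theorem inv_mem_laurentOn (a : V → K) {S : Set V} {v : V} (hv : v ∈ S) :
    (a v)⁻¹ ∈ laurentOn a S :=
  Algebra.subset_adjoin (Or.inr ⟨v, hv, rfl⟩)

theorem laurentOn_le {a : V → K} {S : Set V} {E : Subalgebra ℤ K} (h : ∀ v ∈ S, a v ∈ E)
    (h' : ∀ v ∈ S, (a v)⁻¹ ∈ E) : laurentOn a S ≤ E := by
  refine Algebra.adjoin_le ?_
  rintro _ (⟨v, hv, rfl⟩ | ⟨v, hv, rfl⟩)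
  exacts [h v hv, h' v hv]

theorem laurentOn_univ_le_adjoin (a : V → K) (k : V) :
    laurentOn a Set.univ ≤ Algebra.adjoin ℤ ((laurentOn a {k}ᶜ : Set K) ∪ {a k, (a k)⁻¹}) := by
  refine laurentOn_le (fun v _ => ?_) fun v _ => ?_
  · by_cases h : v = k
    · subst h
      exact Algebra.subset_adjoin (Or.inr (Or.inl rfl))
    · exact Algebra.subset_adjoin (Or.inl (mem_laurentOn a h))
  · by_cases h : v = k
    · subst h
      exact Algebra.subset_adjoin (Or.inr (Or.inr rfl))
    · exact Algebra.subset_adjoin (Or.inl (inv_mem_laurentOn a h))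

theorem adjoin_le_laurentOn_univ (a : V → K) (k : V) :
    Algebra.adjoin ℤ ((laurentOn a {k}ᶜ : Set K) ∪ {a k, (a k)⁻¹}) ≤ laurentOn a Set.univ := by
  refine Algebra.adjoin_le ?_
  rintro x (hx | rfl | rfl)
  · exact laurentOn_le (fun v _ => mem_laurentOn a (Set.mem_univ v))
      (fun v _ => inv_mem_laurentOn a (Set.mem_univ v)) hx
  · exact mem_laurentOn a (Set.mem_univ k)
  · exact inv_mem_laurentOn a (Set.mem_univ k)

theorem prod_pow_mem {a : V → K} {E : Subalgebra ℤ K} {s : Finset V} {e : V → ℕ}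
    (h : ∀ v ∈ s, e v ≠ 0 → a v ∈ E) : ∏ v ∈ s, a v ^ e v ∈ E := by
  refine prod_mem fun v hv => ?_
  by_cases h0 : e v = 0
  · simp [h0]
  · exact pow_mem (h v hv h0) _

theorem inv_prod_pow_mem {a : V → K} {E : Subalgebra ℤ K} {s : Finset V} {e : V → ℕ}
    (h : ∀ v ∈ s, e v ≠ 0 → (a v)⁻¹ ∈ E) : (∏ v ∈ s, a v ^ e v)⁻¹ ∈ E := by
  rw [← Finset.prod_inv_distrib]
  simp only [← inv_pow]
  exact prod_pow_mem h

variable [Fintype V]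

/-- The right-hand side of the exchange relation at `k`. -/
noncomputable def exchange (q : IceQuiver V) (a : V → K) (k : V) : K :=
  ∏ j, a j ^ (q.Q k j).toNat + ∏ j, a j ^ (-q.Q k j).toNat

theorem exchange_op (q : IceQuiver V) (a : V → K) (k : V) :
    exchange q.op a k = exchange q a k := by
  simp only [exchange, IceQuiver.op, neg_neg]
  exact add_comm _ _

theorem exchange_congr {q q' : IceQuiver V} {a a' : V → K} {k : V}
    (hq : ∀ j, q'.Q k j = q.Q k j) (ha : ∀ j, q.Q k j ≠ 0 → a' j = a j) :
    exchange q' a' k = exchange q a k := by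
  unfold exchange
  congr 1 <;>
  · refine Finset.prod_congr rfl fun j _ => ?_
    rw [hq]
    by_cases h : q.Q k j = 0
    · simp [h]
    · rw [ha j h]

theorem exchange_mem {q : IceQuiver V} {a : V → K} {k : V} {E : Subalgebra ℤ K}
    (h : ∀ j, q.Q k j ≠ 0 → a j ∈ E) : exchange q a k ∈ E :=
  add_mem (prod_pow_mem fun j _ hj => h j fun h0 => hj (by simp [h0]))
    (prod_pow_mem fun j _ hj => h j fun h0 => hj (by simp [h0]))

variable [DecidableEq V]

/-- The cluster of the seed `(q, a)` after mutation at `k`. -/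
noncomputable def mutateCluster (q : IceQuiver V) (a : V → K) (k : V) : V → K :=
  Function.update a k (exchange q a k * (a k)⁻¹)

theorem mutateCluster_self (q : IceQuiver V) (a : V → K) (k : V) :
    mutateCluster q a k k = exchange q a k * (a k)⁻¹ := Function.update_self ..

theorem mutateCluster_of_ne (q : IceQuiver V) (a : V → K) {k v : V} (h : v ≠ k) :
    mutateCluster q a k v = a v := Function.update_of_ne h ..

theorem mutateCluster_op (q : IceQuiver V) (a : V → K) (k : V) :
    mutateCluster q.op a k = mutateCluster q a k := by
  rw [mutateCluster, exchange_op, mutateCluster]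

theorem exchange_mutate_self (q : IceQuiver V) (a : V → K) (k : V) :
    exchange (q.mutate k) (mutateCluster q a k) k = exchange q a k := by
  rw [← exchange_op q]
  refine exchange_congr (q.mutate_Q_left k) fun j hj => mutateCluster_of_ne q a ?_
  rintro rfl
  exact hj (by simp [IceQuiver.op, q.Q_self])

theorem mutateCluster_mutateCluster {q : IceQuiver V} {a : V → K} {k : V} (hk : a k ≠ 0)
    (he : exchange q a k ≠ 0) : mutateCluster (q.mutate k) (mutateCluster q a k) k = a := by
  rw [mutateCluster, exchange_mutate_self, mutateCluster_self]
  funext v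
  by_cases h : v = k
  · subst h
    rw [Function.update_self]
    field_simp
  · rw [Function.update_of_ne h, mutateCluster_of_ne q a h]

section Independent

variable [Algebra ℚ K]

omit [DecidableEq V] in
theorem exchange_ne_zero {a : V → K} (ha : AlgebraicIndependent ℚ a) (q : IceQuiver V) (k : V) :
    exchange q a k ≠ 0 := by
  intro h
  have h1 : MvPolynomial.aeval a ((∏ j, MvPolynomial.X j ^ (q.Q k j).toNat
      + ∏ j, MvPolynomial.X j ^ (-q.Q k j).toNat : MvPolynomial V ℚ)) = 0 := by
    simpa [exchange] using h
  have h2 := congrArg (MvPolynomial.eval fun _ => (1 : ℚ)) (ha.eq_zero_of_aeval_eq_zero _ h1)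
  norm_num at h2

omit [Fintype V] [DecidableEq V] in
theorem transcendental_of_forall_mem_adjoin {a : V → K} (ha : AlgebraicIndependent ℚ a) {k : V}
    {C : Subalgebra ℤ K} (hC : ∀ c ∈ C, c ∈ IntermediateField.adjoin ℚ (a '' {k}ᶜ)) :
    Transcendental C (a k) := by
  have h1 : Transcendental (Algebra.adjoin ℚ (a '' {k}ᶜ)) (a k) :=
    ha.transcendental_adjoin (fun h => h rfl)
  have h2 : Transcendental (IntermediateField.adjoin ℚ (a '' {k}ᶜ)) (a k) := by
    intro h
    open IntermediateField.algebraAdjoinAdjoin in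
    exact h1 ((IsFractionRing.isAlgebraic_iff (Algebra.adjoin ℚ (a '' {k}ᶜ))
      (IntermediateField.adjoin ℚ (a '' {k}ᶜ)) K).mpr h)
  rintro ⟨p, hp0, hp⟩
  let f : C →+* IntermediateField.adjoin ℚ (a '' {k}ᶜ) :=
    { toFun := fun c => ⟨c, hC c c.2⟩
      map_one' := rfl
      map_mul' := fun _ _ => rfl
      map_zero' := rfl
      map_add' := fun _ _ => rfl }
  have hf : Function.Injective f := fun x y h => by
    have h' : ((f x : IntermediateField.adjoin ℚ (a '' {k}ᶜ)) : K) = f y := by rw [h]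
    exact Subtype.ext h'
  refine h2 ⟨p.map f, (Polynomial.map_ne_zero_iff hf).mpr hp0, ?_⟩
  rw [Polynomial.aeval_def, Polynomial.eval₂_map]
  exact hp

omit [Fintype V] [DecidableEq V] in
theorem laurentOn_le_adjoin (a : V → K) (k : V) {c : K} (hc : c ∈ laurentOn a {k}ᶜ) :
    c ∈ IntermediateField.adjoin ℚ (a '' {k}ᶜ) := by
  let E : Subalgebra ℤ K :=
    (IntermediateField.adjoin ℚ (a '' {k}ᶜ)).toSubalgebra.restrictScalars ℤ
  have h : laurentOn a {k}ᶜ ≤ E :=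
    laurentOn_le (fun v hv => IntermediateField.subset_adjoin _ _ ⟨v, hv, rfl⟩)
      fun v hv => inv_mem (S := IntermediateField ℚ K)
        (IntermediateField.subset_adjoin _ _ ⟨v, hv, rfl⟩)
  exact h hc

theorem algebraicIndependent_mutateCluster {a : V → K} (ha : AlgebraicIndependent ℚ a)
    (q : IceQuiver V) (k : V) : AlgebraicIndependent ℚ (mutateCluster q a k) := by
  have himage : mutateCluster q a k '' {k}ᶜ = a '' {k}ᶜ :=
    Set.image_congr fun v hv => mutateCluster_of_ne q a hv
  rw [AlgebraicIndependent.iff_transcendental_adjoin_image k] at ha ⊢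
  have hfun : (fun j : {j // j ≠ k} => mutateCluster q a k j) = fun j : {j // j ≠ k} => a j :=
    funext fun j => mutateCluster_of_ne q a j.2
  rw [hfun, himage]
  refine ⟨ha.1, fun h => ha.2 ?_⟩
  have hne := exchange_ne_zero ((AlgebraicIndependent.iff_transcendental_adjoin_image k).mpr ha) q k
  have hmem : exchange q a k ∈ Algebra.adjoin ℚ (a '' {k}ᶜ) := by
    let E : Subalgebra ℤ K := (Algebra.adjoin ℚ (a '' {k}ᶜ)).restrictScalars ℤ
    have hE : ∀ j ≠ k, a j ∈ E := fun j hj =>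
      Algebra.subset_adjoin (R := ℚ) (Set.mem_image_of_mem a hj)
    have h : exchange q a k ∈ E := exchange_mem fun j hj => hE j (by
      rintro rfl
      exact hj (q.Q_self _))
    exact h
  have halg : IsAlgebraic (Algebra.adjoin ℚ (a '' {k}ᶜ)) (exchange q a k) :=
    isAlgebraic_algebraMap (⟨_, hmem⟩ : Algebra.adjoin ℚ (a '' {k}ᶜ))
  have : a k = exchange q a k * (mutateCluster q a k k)⁻¹ := by
    rw [mutateCluster_self, mul_inv, inv_inv, mul_inv_cancel_left₀ hne]
  rw [this]
  exact halg.mul h.inv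

omit [Fintype V] [DecidableEq V] in
theorem transcendental_laurentOn {a : V → K} (ha : AlgebraicIndependent ℚ a) (k : V) :
    Transcendental (laurentOn a {k}ᶜ) (a k) :=
  transcendental_of_forall_mem_adjoin ha fun _ hc => laurentOn_le_adjoin a k hc

end Independent

end Exchange

end ClusterAlg

/-! ### Comparison of the Laurent rings of nearby seeds -/

namespace ClusterAlg

section Square

variable {V K : Type*} [Field K]

theorem exists_add_pow_eq {E : Subalgebra ℤ K} {s y r : K} (hs : s ∈ E) (hy : y ∈ E) (hr : r ∈ E)
    (n : ℕ) : ∃ g ∈ E, (s + y * r) ^ n = s ^ n + y * g := by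
  induction n with
  | zero => exact ⟨0, zero_mem _, by simp⟩
  | succ n ih =>
    obtain ⟨g, hg, h⟩ := ih
    refine ⟨g * (s + y * r) + s ^ n * r, add_mem (mul_mem hg (add_mem hs (mul_mem hy hr)))
      (mul_mem (pow_mem hs n) hr), ?_⟩
    rw [pow_succ, h]
    ring

variable [Fintype V] [DecidableEq V]

/-- The exchange relation at `k` with the variable `a j` singled out. -/
theorem exchange_eq_of_nonpos (q : IceQuiver V) (a : V → K) {j k : V} (h : q.Q k j ≤ 0) :
    exchange q a k = ∏ v ∈ Finset.univ.erase j, a v ^ (q.Q k v).toNat +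
      a j ^ (-q.Q k j).toNat * ∏ v ∈ Finset.univ.erase j, a v ^ (-q.Q k v).toNat := by
  rw [exchange, ← Finset.mul_prod_erase _ (fun v => a v ^ (q.Q k v).toNat) (Finset.mem_univ j),
    ← Finset.mul_prod_erase _ (fun v => a v ^ (-q.Q k v).toNat) (Finset.mem_univ j),
    Int.toNat_of_nonpos h, pow_zero, one_mul]

theorem exchange_eq_of_nonneg (q : IceQuiver V) (a : V → K) {j k : V} (h : 0 ≤ q.Q k j) :
    exchange q a k = ∏ v ∈ Finset.univ.erase j, a v ^ (-q.Q k v).toNat +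
      a j ^ (q.Q k j).toNat * ∏ v ∈ Finset.univ.erase j, a v ^ (q.Q k v).toNat := by
  have := exchange_eq_of_nonpos q.op a (j := j) (k := k) (by simpa [IceQuiver.op] using h)
  rw [exchange_op] at this
  simpa only [IceQuiver.op, neg_neg] using this

/-- Mutation at `k` does not change the exchange relations at the vertices that are not joined
to `k`. -/
theorem exchange_mutate_of_eq_zero (q : IceQuiver V) (a : V → K) {j k : V} (hjk : j ≠ k)
    (hc : q.Q j k = 0) : exchange (q.mutate k) (mutateCluster q a k) j = exchange q a j := by
  refine exchange_congr (fun v => ?_) fun v hv => mutateCluster_of_ne q a ?_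
  · by_cases hvk : v = k
    · subst hvk
      rw [IceQuiver.mutate_Q_right, hc, neg_zero]
    · rw [IceQuiver.mutate_Q_of_nonneg _ hvk hjk hc.ge, hc, zero_mul, add_zero]
  · rintro rfl
    exact hv hc

theorem self_mul_mutateCluster_self (q : IceQuiver V) {a : V → K} {k : V} (h : a k ≠ 0) :
    a k * mutateCluster q a k k = exchange q a k := by
  rw [mutateCluster_self]
  field_simp

/-- The variable `a_j'` obtained from `a` by mutation at `j` is in the Laurent ring of the cluster
obtained by mutation at `k` and then at `j`, if there are arrows `j → k`: modulo `a_j`, the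
numerator of `a_j'` is a multiple of the exchange polynomial at `j` after mutation at `k`. -/
theorem mutateCluster_self_mem_of_pos (q : IceQuiver V) {a : V → K} {j k : V} (hjk : j ≠ k)
    (hj0 : a j ≠ 0) (hk0 : a k ≠ 0) (hc : 0 < q.Q j k) {E : Subalgebra ℤ K}
    (hE : ∀ v, a v ∈ E) (hk : (mutateCluster q a k k)⁻¹ ∈ E) (hk0' : mutateCluster q a k k ≠ 0)
    (hj : mutateCluster (q.mutate k) (mutateCluster q a k) j j ∈ E) :
    mutateCluster q a j j ∈ E := by
  set a₁ := mutateCluster q a k with ha₁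
  set q₁ := q.mutate k
  set c := (q.Q j k).toNat with hcdef
  have hcc : (c : ℤ) = q.Q j k := Int.toNat_of_nonneg hc.le
  have hkj : q.Q k j = - q.Q j k := q.skew k j
  set p := ∏ v ∈ Finset.univ.erase k, a v ^ (q.Q j v).toNat
  set t := ∏ v ∈ Finset.univ.erase k, a v ^ (-q.Q j v).toNat
  set s := ∏ v ∈ Finset.univ.erase j, a v ^ (q.Q k v).toNat
  set r := ∏ v ∈ Finset.univ.erase j, a v ^ (-q.Q k v).toNat
  have hprod : ∀ (S : Finset V) (e : V → ℕ), ∏ v ∈ S, a v ^ e v ∈ E :=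
    fun S e => prod_pow_mem fun v _ _ => hE v
  -- The exchange relations at `j` and `k` in `a`.
  have hPj : a j * mutateCluster q a j j = t + a k ^ c * p := by
    rw [self_mul_mutateCluster_self q hj0, exchange_eq_of_nonneg q a hc.le]
  have hPk : a k * a₁ k = s + a j ^ c * r := by
    rw [ha₁, self_mul_mutateCluster_self q hk0, exchange_eq_of_nonpos q a (j := j) (by omega), hkj,
      neg_neg]
  have hs : s = ∏ v ∈ Finset.univ.erase k, a v ^ (q.Q k v).toNat := by
    have h1 := Finset.mul_prod_erase Finset.univ (fun v => a v ^ (q.Q k v).toNat)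
      (Finset.mem_univ j)
    have h2 := Finset.mul_prod_erase Finset.univ (fun v => a v ^ (q.Q k v).toNat)
      (Finset.mem_univ k)
    rw [← h1] at h2
    simp only [q.Q_self, hkj, Int.toNat_zero, pow_zero, one_mul,
      Int.toNat_of_nonpos (show - q.Q j k ≤ 0 by omega)] at h2
    exact h2.symm
  -- The exchange relation at `j` after mutation at `k`.
  set e : V → ℤ := fun v => q.Q j v + c * (q.Q k v).toNat with he
  have hPj' : a j * mutateCluster q₁ a₁ j j
      = ∏ v ∈ Finset.univ.erase k, a v ^ (e v).toNat
        + a₁ k ^ c * ∏ v ∈ Finset.univ.erase k, a v ^ (-e v).toNat := by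
    have h1 : q₁.Q j k = - q.Q j k := q.mutate_Q_right j k
    have haj : a j = a₁ j := (mutateCluster_of_ne q a hjk).symm
    rw [haj, self_mul_mutateCluster_self q₁ (haj ▸ hj0),
      exchange_eq_of_nonpos q₁ a₁ (j := k) (k := j) (by omega), h1, neg_neg]
    have h2 : ∀ v ∈ Finset.univ.erase k, q₁.Q j v = e v ∧ a₁ v = a v := by
      intro v hv
      have hvk := Finset.ne_of_mem_erase hv
      exact ⟨by rw [he, hcc]; exact q.mutate_Q_of_nonneg hvk hjk hc.le,
        mutateCluster_of_ne q a hvk⟩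
    congr 1
    · exact Finset.prod_congr rfl fun v hv => by rw [(h2 v hv).1, (h2 v hv).2]
    · congr 1
      exact Finset.prod_congr rfl fun v hv => by rw [(h2 v hv).1, (h2 v hv).2]
  -- The common monomial factor of `s ^ c * p` and `t`.
  set f : V → ℕ := fun v => (q.Q j v).toNat + c * (q.Q k v).toNat - (e v).toNat with hf
  set μ := ∏ v ∈ Finset.univ.erase k, a v ^ f v
  have hμ1 : s ^ c * p = μ * ∏ v ∈ Finset.univ.erase k, a v ^ (e v).toNat := by
    rw [hs, ← Finset.prod_pow, ← Finset.prod_mul_distrib, ← Finset.prod_mul_distrib]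
    refine Finset.prod_congr rfl fun v _ => ?_
    rw [← pow_mul, ← pow_add, ← pow_add]
    congr 1
    simp only [hf, he]
    rw [mul_comm _ c]
    have : (0 : ℤ) ≤ c * (q.Q k v).toNat := by positivity
    zify
    omega
  have hμ2 : t = μ * ∏ v ∈ Finset.univ.erase k, a v ^ (-e v).toNat := by
    rw [← Finset.prod_mul_distrib]
    refine Finset.prod_congr rfl fun v _ => ?_
    rw [← pow_add]
    congr 1
    simp only [hf, he]
    have : (0 : ℤ) ≤ c * (q.Q k v).toNat := by positivity
    zify
    omega
  obtain ⟨d, hd⟩ : ∃ d, c = d + 1 := ⟨c - 1, by omega⟩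
  obtain ⟨g, hg, hg'⟩ := exists_add_pow_eq (hprod _ _ : s ∈ E) (hE j)
    (mul_mem (pow_mem (hE j) d) (hprod _ _ : r ∈ E)) c
  have key : a j * (a₁ k ^ c * mutateCluster q a j j)
      = a j * (μ * mutateCluster q₁ a₁ j j + g * p) := by
    have h1 : (a k * a₁ k) ^ c = s ^ c + a j * g := by
      rw [← hg', hPk, hd, pow_succ']
      ring
    rw [mul_pow] at h1
    linear_combination a₁ k ^ c * hPj + p * h1 + hμ1 + a₁ k ^ c * hμ2 - μ * hPj'
  have h2 : mutateCluster q a j j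
      = ((a₁ k)⁻¹) ^ c * (μ * mutateCluster q₁ a₁ j j + g * p) := by
    rw [← mul_left_cancel₀ hj0 key, ← mul_assoc, ← mul_pow, inv_mul_cancel₀ hk0', one_pow,
      one_mul]
  rw [h2]
  exact mul_mem (pow_mem hk _) (add_mem (mul_mem (hprod _ _) hj) (mul_mem hg (hprod _ _)))

theorem mutateCluster_self_mem (q : IceQuiver V) {a : V → K} {j k : V} (hjk : j ≠ k)
    (hj0 : a j ≠ 0) (hk0 : a k ≠ 0) (hc : q.Q j k ≠ 0) {E : Subalgebra ℤ K}
    (hE : ∀ v, a v ∈ E) (hk : (mutateCluster q a k k)⁻¹ ∈ E) (hk0' : mutateCluster q a k k ≠ 0)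
    (hj : mutateCluster (q.mutate k) (mutateCluster q a k) j j ∈ E) :
    mutateCluster q a j j ∈ E := by
  rcases lt_or_gt_of_ne hc with hc | hc
  · have := mutateCluster_self_mem_of_pos q.op hjk hj0 hk0 (by simpa [IceQuiver.op] using hc) hE
      (by rwa [mutateCluster_op]) (by rwa [mutateCluster_op])
      (by rwa [mutateCluster_op, IceQuiver.op_mutate, mutateCluster_op])
    rwa [mutateCluster_op] at this
  · exact mutateCluster_self_mem_of_pos q hjk hj0 hk0 hc hE hk hk0' hj

/-- If there are arrows from `k` to `j` and the `a_v` with arrows from `v` to `k` are invertible,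
then one of the two monomials of the exchange relation at `k` is invertible and the other one is a
multiple of `a_j`, so that `a_k` and `a_j` generate the unit ideal. -/
theorem exists_mul_add_mul_eq_one_of_pos {a : V → K} (ha : ∀ v, a v ≠ 0) (q : IceQuiver V)
    {j k : V} (hc : 0 < q.Q k j) {E : Subalgebra ℤ K} (hE : ∀ v, a v ∈ E)
    (hE' : ∀ v, q.Q k v < 0 → (a v)⁻¹ ∈ E) (hk : mutateCluster q a k k ∈ E) :
    ∃ r ∈ E, ∃ s ∈ E, r * a k + s * a j = 1 := by
  have hP := exchange_eq_of_nonneg q a hc.le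
  rw [← self_mul_mutateCluster_self q (ha k)] at hP
  set s := ∏ v ∈ Finset.univ.erase j, a v ^ (-q.Q k v).toNat
  set r := ∏ v ∈ Finset.univ.erase j, a v ^ (q.Q k v).toNat
  have hs : s⁻¹ ∈ E := inv_prod_pow_mem fun v hv hv' => hE' v (by omega)
  have hs0 : s ≠ 0 := Finset.prod_ne_zero_iff.mpr fun v _ => pow_ne_zero _ (ha v)
  have hr : r ∈ E := prod_pow_mem fun v _ _ => hE v
  obtain ⟨d, hd⟩ : ∃ d, (q.Q k j).toNat = d + 1 := ⟨(q.Q k j).toNat - 1, by omega⟩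
  rw [hd, pow_succ] at hP
  refine ⟨s⁻¹ * mutateCluster q a k k, mul_mem hs hk, -(s⁻¹ * (a j ^ d * r)),
    neg_mem (mul_mem hs (mul_mem (pow_mem (hE j) d) hr)), ?_⟩
  have : s⁻¹ * s = 1 := inv_mul_cancel₀ hs0
  linear_combination s⁻¹ * hP + this

theorem exists_mul_add_mul_eq_one_of_ne_zero {a : V → K} (ha : ∀ v, a v ≠ 0) (q : IceQuiver V)
    {j k : V} (hc : q.Q k j ≠ 0) {E : Subalgebra ℤ K} (hE : ∀ v, a v ∈ E)
    (hE' : ∀ v, v ≠ j → v ≠ k → (a v)⁻¹ ∈ E) (hk : mutateCluster q a k k ∈ E) :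
    ∃ r ∈ E, ∃ s ∈ E, r * a k + s * a j = 1 := by
  wlog h : 0 < q.Q k j generalizing q
  · exact this q.op (by simpa [IceQuiver.op] using hc) (by rwa [mutateCluster_op])
      (by simp only [IceQuiver.op]; omega)
  refine exists_mul_add_mul_eq_one_of_pos ha q h hE (fun v hv => hE' v ?_ ?_) hk
  · rintro rfl
    omega
  · rintro rfl
    exact hv.ne (q.Q_self v)

variable [Algebra ℚ K]

/-- An element in the Laurent rings of `a` and of its mutation at `k` is a polynomial in `a_k` and
`a_k'` over the Laurent ring of the other variables. -/
theorem mem_adjoin_of_mem_laurentOn {a : V → K} (ha : AlgebraicIndependent ℚ a)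
    (q : IceQuiver V) (k : V) {u : K} (h : u ∈ laurentOn a Set.univ)
    (hk : u ∈ laurentOn (mutateCluster q a k) Set.univ) :
    u ∈ Algebra.adjoin ℤ ((laurentOn a {k}ᶜ : Set K) ∪ {a k, mutateCluster q a k k}) := by
  have hL : laurentOn (mutateCluster q a k) {k}ᶜ = laurentOn a {k}ᶜ := by
    unfold laurentOn
    congr 2
    · exact Set.image_congr fun v hv => mutateCluster_of_ne q a hv
    · exact Set.image_congr fun v hv => congrArg _ (mutateCluster_of_ne q a hv)
  refine mem_adjoin_of_mem_adjoin_inv _ (transcendental_laurentOn ha k) (P := exchange q a k)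
    (exchange_mem fun j hj => mem_laurentOn a ?_) (exchange_ne_zero ha q k)
    (self_mul_mutateCluster_self q (ha.ne_zero k)) (laurentOn_univ_le_adjoin a k h)
    (hL ▸ laurentOn_univ_le_adjoin _ k hk)
  rintro rfl
  exact hj (q.Q_self _)

/-- A function in the Laurent rings of `a` and of its mutations at `j` and `k` is in the Laurent
ring of the mutation at `k` and then `j`, if there are arrows between `j` and `k`. -/
theorem mem_laurentOn_of_ne_zero {a : V → K} (ha : AlgebraicIndependent ℚ a) (q : IceQuiver V)
    {j k : V} (hjk : j ≠ k) (hc : q.Q j k ≠ 0) {u : K} (h : u ∈ laurentOn a Set.univ)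
    (hj : u ∈ laurentOn (mutateCluster q a j) Set.univ)
    (hk : u ∈ laurentOn (mutateCluster q a k) Set.univ) :
    u ∈ laurentOn (mutateCluster (q.mutate k) (mutateCluster q a k) j) Set.univ := by
  set a₁ := mutateCluster q a k with ha₁
  set q₁ := q.mutate k
  set a₂ := mutateCluster q₁ a₁ j with ha₂
  have hi₁ : AlgebraicIndependent ℚ a₁ := algebraicIndependent_mutateCluster ha q k
  have hi₂ : AlgebraicIndependent ℚ a₂ := algebraicIndependent_mutateCluster hi₁ q₁ j
  have hck : q.Q k j ≠ 0 := by rw [q.skew]; omega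
  -- The ring in which `a_j` and `a_k` generate the unit ideal.
  let E : Subalgebra ℤ K := Algebra.adjoin ℤ ((laurentOn a {j, k}ᶜ : Set K) ∪
    {a j, mutateCluster q a j j, a k, mutateCluster q a k k})
  have hLE : ∀ v, v ≠ j → v ≠ k → a v ∈ E ∧ (a v)⁻¹ ∈ E := fun v hvj hvk =>
    ⟨Algebra.subset_adjoin (Or.inl (mem_laurentOn a (by simp [hvj, hvk]))),
      Algebra.subset_adjoin (Or.inl (inv_mem_laurentOn a (by simp [hvj, hvk])))⟩
  have hjE : a j ∈ E := Algebra.subset_adjoin (Or.inr (by simp))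
  have hkE : a k ∈ E := Algebra.subset_adjoin (Or.inr (by simp))
  have hjE' : mutateCluster q a j j ∈ E := Algebra.subset_adjoin (Or.inr (by simp))
  have hkE' : mutateCluster q a k k ∈ E := Algebra.subset_adjoin (Or.inr (by simp))
  have hE : ∀ v, a v ∈ E := by
    intro v
    by_cases hvj : v = j
    · exact hvj ▸ hjE
    by_cases hvk : v = k
    · exact hvk ▸ hkE
    exact (hLE v hvj hvk).1
  have huE : u ∈ E := by
    obtain ⟨r, hr, s, hs, hrs⟩ := exists_mul_add_mul_eq_one_of_ne_zero ha.ne_zero q hck hE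
      (fun v hvj hvk => (hLE v hvj hvk).2) hkE'
    have loc : ∀ i l, ({i, l} : Set V) = {j, k} → a i ∈ E → mutateCluster q a i i ∈ E →
        u ∈ Algebra.adjoin ℤ ((laurentOn a {i}ᶜ : Set K) ∪ {a i, mutateCluster q a i i}) →
        ∃ N : ℕ, a l ^ N * u ∈ E := by
      intro i l hil hi hi' hu
      refine exists_pow_mul_mem_of_mem_adjoin (hE l) ?_ hu
      rintro t (ht | rfl | rfl)
      · refine exists_pow_mul_mem_of_mem_adjoin (hE l) ?_ ht
        rintro _ (⟨v, hv, rfl⟩ | ⟨v, hv, rfl⟩)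
        · exact ⟨0, by simpa using hE v⟩
        · by_cases hvl : v = l
          · subst hvl
            exact ⟨1, by simp [ha.ne_zero]⟩
          · have hv' : v ∉ ({j, k} : Set V) := by
              rw [← hil]
              simpa [hvl] using hv
            simp only [Set.mem_insert_iff, Set.mem_singleton_iff, not_or] at hv'
            exact ⟨0, by simpa using (hLE v hv'.1 hv'.2).2⟩
      · exact ⟨0, by simpa using hi⟩
      · exact ⟨0, by simpa using hi'⟩
    exact mem_of_pow_mul_mem_of_add_eq_one hkE hjE hr hs hrs
      (loc j k rfl hjE hjE' (mem_adjoin_of_mem_laurentOn ha q j h hj))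
      (loc k j (Set.pair_comm k j) hkE hkE' (mem_adjoin_of_mem_laurentOn ha q k h hk))
  -- This ring is contained in the target.
  set L := laurentOn a₂ Set.univ
  have h₂ : ∀ v, a₂ v ∈ L := fun v => mem_laurentOn a₂ (Set.mem_univ v)
  have h₂' : ∀ v, (a₂ v)⁻¹ ∈ L := fun v => inv_mem_laurentOn a₂ (Set.mem_univ v)
  have h₂₁ : ∀ v, v ≠ j → a₂ v = a₁ v := fun v hv => mutateCluster_of_ne q₁ a₁ hv
  have h₂₀ : ∀ v, v ≠ j → v ≠ k → a₂ v = a v := fun v hv hv' =>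
    (h₂₁ v hv).trans (mutateCluster_of_ne q a hv')
  have h₁L : ∀ v, v ≠ j → a₁ v ∈ L := fun v hv => h₂₁ v hv ▸ h₂ v
  have hjL : a j ∈ L := by
    have h1 : a j * a₂ j = exchange q₁ a₁ j := by
      rw [ha₂, ← self_mul_mutateCluster_self q₁ (hi₁.ne_zero j), ha₁, mutateCluster_of_ne q a hjk]
    have h2 : a j = exchange q₁ a₁ j * (a₂ j)⁻¹ := by
      rw [← h1, mul_inv_cancel_right₀ (hi₂.ne_zero j)]
    rw [h2]
    refine mul_mem (exchange_mem fun v hv => h₁L v ?_) (h₂' j)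
    rintro rfl
    exact hv (q₁.Q_self _)
  have hvL : ∀ v, v ≠ k → a v ∈ L := by
    intro v hvk
    by_cases hvj : v = j
    · exact hvj ▸ hjL
    · exact h₂₀ v hvj hvk ▸ h₂ v
  have hkk : (a₁ k)⁻¹ ∈ L := h₂₁ k hjk.symm ▸ h₂' k
  have hkL : a k ∈ L := by
    have h2 : a k = exchange q a k * (a₁ k)⁻¹ := by
      rw [← self_mul_mutateCluster_self q (ha.ne_zero k), mul_inv_cancel_right₀ (hi₁.ne_zero k)]
    rw [h2]
    refine mul_mem (exchange_mem fun v hv => hvL v ?_) hkk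
    rintro rfl
    exact hv (q.Q_self _)
  have haL : ∀ v, a v ∈ L := by
    intro v
    by_cases hvk : v = k
    · exact hvk ▸ hkL
    · exact hvL v hvk
  have hjL' : mutateCluster q a j j ∈ L := mutateCluster_self_mem q hjk (ha.ne_zero j)
    (ha.ne_zero k) hc haL hkk (hi₁.ne_zero k) (h₂ j)
  have hEL : E ≤ L := by
    refine Algebra.adjoin_le ?_
    rintro x (hx | rfl | rfl | rfl | rfl)
    · refine laurentOn_le (fun v _ => haL v) (fun v hv => ?_) hx
      simp only [Set.mem_compl_iff, Set.mem_insert_iff, Set.mem_singleton_iff, not_or] at hv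
      exact h₂₀ v hv.1 hv.2 ▸ h₂' v
    exacts [hjL, hjL', hkL, h₁L k hjk.symm]
  exact hEL huE

/-- The analogue of `mem_laurentOn_of_ne_zero` if there are no arrows between `j` and `k`. A
variable `a_z` that occurs in the exchange relation at `k`, but not in that at `j`, forces the
two right-hand sides to be coprime. -/
theorem mem_laurentOn_of_eq_zero {a : V → K} (ha : AlgebraicIndependent ℚ a) (q : IceQuiver V)
    {j k z : V} (hjk : j ≠ k) (hc : q.Q j k = 0) (hkz : q.Q k z ≠ 0) (hjz : q.Q j z = 0) {u : K}
    (hj : u ∈ laurentOn (mutateCluster q a j) Set.univ)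
    (hk : u ∈ laurentOn (mutateCluster q a k) Set.univ) :
    u ∈ laurentOn (mutateCluster (q.mutate k) (mutateCluster q a k) j) Set.univ := by
  wlog h : 0 < q.Q k z generalizing q
  · have := this q.op (by simp [IceQuiver.op, hc]) (by simpa [IceQuiver.op] using hkz)
      (by simp [IceQuiver.op, hjz]) (by rwa [mutateCluster_op]) (by rwa [mutateCluster_op])
      (by simp only [IceQuiver.op]; omega)
    rwa [mutateCluster_op, IceQuiver.op_mutate, mutateCluster_op] at this
  have hck : q.Q k j = 0 := by rw [q.skew]; omega
  have hzk : z ≠ k := by rintro rfl; exact hkz (q.Q_self _)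
  have hzj : z ≠ j := by rintro rfl; exact hkz hck
  set a₁ := mutateCluster q a k with ha₁
  set q₁ := q.mutate k
  set a₂ := mutateCluster q₁ a₁ j with ha₂
  have hi₁ : AlgebraicIndependent ℚ a₁ := algebraicIndependent_mutateCluster ha q k
  have hi₂ : AlgebraicIndependent ℚ a₂ := algebraicIndependent_mutateCluster hi₁ q₁ j
  set L := laurentOn a₂ Set.univ
  have h₂ : ∀ v, a₂ v ∈ L := fun v => mem_laurentOn a₂ (Set.mem_univ v)
  have h₂' : ∀ v, (a₂ v)⁻¹ ∈ L := fun v => inv_mem_laurentOn a₂ (Set.mem_univ v)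
  have h₂₁ : ∀ v, v ≠ j → a₂ v = a₁ v := fun v hv => mutateCluster_of_ne q₁ a₁ hv
  have h₂₀ : ∀ v, v ≠ j → v ≠ k → a₂ v = a v := fun v hv hv' =>
    (h₂₁ v hv).trans (mutateCluster_of_ne q a hv')
  have hz₂ : a₂ z = a z := h₂₀ z hzj hzk
  have hjj : a₂ j = mutateCluster q a j j := by
    rw [ha₂, mutateCluster_self, exchange_mutate_of_eq_zero q a hjk hc, mutateCluster_self, ha₁,
      mutateCluster_of_ne q a hjk]
  -- In `C`, the exchange polynomial at `k` is a monomial times `1 + m * a_z ^ e`.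
  set C := laurentOn a₂ {z}ᶜ
  set A := ∏ v ∈ Finset.univ.erase z, a v ^ (q.Q k v).toNat
  set B := ∏ v ∈ Finset.univ.erase z, a v ^ (-q.Q k v).toNat
  have hPk : a k * a₁ k = B + a z ^ (q.Q k z).toNat * A := by
    rw [ha₁, self_mul_mutateCluster_self q (ha.ne_zero k), exchange_eq_of_nonneg q a h.le]
  have hne : ∀ v, v ≠ z → q.Q k v ≠ 0 → v ∈ ({z}ᶜ : Set V) ∧ a v = a₂ v := by
    intro v hvz hv
    refine ⟨hvz, (h₂₀ v ?_ ?_).symm⟩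
    · rintro rfl; exact hv hck
    · rintro rfl; exact hv (q.Q_self _)
  have hA : A ∈ C := prod_pow_mem fun v hv hv' => by
    obtain ⟨h1, h2⟩ := hne v (Finset.ne_of_mem_erase hv) (fun h0 => hv' (by simp [h0]))
    rw [h2]
    exact mem_laurentOn a₂ h1
  have hB : B ∈ C := prod_pow_mem fun v hv hv' => by
    obtain ⟨h1, h2⟩ := hne v (Finset.ne_of_mem_erase hv) (fun h0 => hv' (by simp [h0]))
    rw [h2]
    exact mem_laurentOn a₂ h1
  have hB' : B⁻¹ ∈ C := inv_prod_pow_mem fun v hv hv' => by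
    obtain ⟨h1, h2⟩ := hne v (Finset.ne_of_mem_erase hv) (fun h0 => hv' (by simp [h0]))
    rw [h2]
    exact inv_mem_laurentOn a₂ h1
  have hB0 : B ≠ 0 := Finset.prod_ne_zero_iff.mpr fun v _ => pow_ne_zero _ (ha.ne_zero v)
  have hCL : C ≤ L := laurentOn_le (fun v _ => h₂ v) fun v _ => h₂' v
  set w := 1 + B⁻¹ * A * a₂ z ^ (q.Q k z).toNat with hw
  have hwB : a k * a₁ k = B * w := by
    rw [hPk, hw, hz₂]
    field_simp
  have hwL : w ∈ L := add_mem (one_mem _) (mul_mem (hCL (mul_mem hB' hA)) (pow_mem (h₂ z) _))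
  have hjC : exchange q a j ∈ C := exchange_mem fun v hv => by
    have h1 : v ≠ j := by rintro rfl; exact hv (q.Q_self _)
    have h2 : v ≠ k := by rintro rfl; exact hv hc
    rw [← h₂₀ v h1 h2]
    exact mem_laurentOn a₂ (fun h0 => hv (by rw [Set.mem_singleton_iff.mp h0, hjz]))
  refine adjoin_le_laurentOn_univ a₂ z (mem_of_one_add_mul_pow_of_pow_mul_mem C
    (transcendental_laurentOn hi₂ z) (e := (q.Q k z).toNat) (by omega) hjC (mul_mem hB' hA)
    (exchange_ne_zero ha q j) ?_ ?_)
  · refine (exists_pow_mul_mem_of_mem_adjoin (E := L) (y := w) hwL ?_ hj).imp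
      fun N hN => laurentOn_univ_le_adjoin a₂ z hN
    have hcase : ∀ v, v ≠ k → mutateCluster q a j v = a₂ v := by
      intro v hvk
      by_cases hvj : v = j
      · subst hvj
        exact hjj.symm
      · rw [h₂₀ v hvj hvk, mutateCluster_of_ne q a hvj]
    have hk1 : mutateCluster q a j k = a k := mutateCluster_of_ne q a hjk.symm
    have hk2 : a₁ k = a₂ k := (h₂₁ k hjk.symm).symm
    rintro _ (⟨v, -, rfl⟩ | ⟨v, -, rfl⟩)
    · refine ⟨0, ?_⟩
      rw [pow_zero, one_mul]
      by_cases hvk : v = k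
      · subst hvk
        rw [hk1, ← mul_inv_cancel_right₀ (hi₁.ne_zero v) (a v), hwB, hk2]
        exact mul_mem (mul_mem (hCL hB) hwL) (h₂' v)
      · rw [hcase v hvk]
        exact h₂ v
    · by_cases hvk : v = k
      · subst hvk
        refine ⟨1, ?_⟩
        have : w ^ 1 * (a v)⁻¹ = B⁻¹ * a₂ v := by
          rw [pow_one, ← hk2]
          have := ha.ne_zero v
          field_simp
          linear_combination -hwB
        simp only [hk1, this]
        exact mul_mem (hCL hB') (h₂ v)
      · refine ⟨0, ?_⟩
        simp only [pow_zero, one_mul, hcase v hvk]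
        exact h₂' v
  · refine (exists_pow_mul_mem_of_mem_adjoin (E := L) (y := exchange q a j) (hCL hjC) ?_ hk).imp
      fun N hN => laurentOn_univ_le_adjoin a₂ z hN
    have hj1 : a₁ j = a j := mutateCluster_of_ne q a hjk
    have hj2 : a j * a₂ j = exchange q a j := by
      rw [hjj, self_mul_mutateCluster_self q (ha.ne_zero j)]
    rintro _ (⟨v, -, rfl⟩ | ⟨v, -, rfl⟩)
    · refine ⟨0, ?_⟩
      rw [pow_zero, one_mul]
      by_cases hvj : v = j
      · subst hvj
        rw [hj1, ← mul_inv_cancel_right₀ (hi₂.ne_zero v) (a v), hj2]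
        exact mul_mem (hCL hjC) (h₂' v)
      · rw [← h₂₁ v hvj]
        exact h₂ v
    · by_cases hvj : v = j
      · subst hvj
        refine ⟨1, ?_⟩
        have : exchange q a v ^ 1 * (a v)⁻¹ = a₂ v := by
          rw [pow_one, ← hj2, mul_comm (a v), mul_inv_cancel_right₀ (ha.ne_zero v)]
        simp only [hj1, this]
        exact h₂ v
      · refine ⟨0, ?_⟩
        simp only [pow_zero, one_mul, ← h₂₁ v hvj]
        exact h₂' v

end Square

end ClusterAlg

/-! ### The Laurent phenomenon -/

namespace ClusterAlg

section Laurent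

open Polynomial

universe u w

/-- The cluster of the seed `(q, a)` after mutations at the vertices of a list, in this order. -/
noncomputable def mutateWord {V : Type u} {K : Type w} [Fintype V] [DecidableEq V] [Field K] :
    IceQuiver V → (V → K) → List V → V → K
  | _, a, [] => a
  | q, a, k :: l => mutateWord (q.mutate k) (mutateCluster q a k) l

section Specialization

variable {K : Type w} [Field K]

variable (K) in
/-- The specialization of rational functions in `z` at `z = 1`, where it is defined. It is encoded
by its graph. -/
noncomputable def specializationGraph : Subalgebra ℤ (RatFunc K × K) where
  carrier := {x | ∃ p q : K[X], q.eval 1 ≠ 0 ∧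
    x.1 * algebraMap K[X] (RatFunc K) q = algebraMap K[X] (RatFunc K) p ∧
    x.2 * q.eval 1 = p.eval 1}
  mul_mem' := by
    rintro x y ⟨p, q, hq, h1, h2⟩ ⟨p', q', hq', h1', h2'⟩
    refine ⟨p * p', q * q', by simp [hq, hq'], ?_, ?_⟩
    · rw [map_mul, map_mul, ← h1, ← h1', Prod.fst_mul]
      ring
    · rw [eval_mul, eval_mul, ← h2, ← h2', Prod.snd_mul]
      ring
  add_mem' := by
    rintro x y ⟨p, q, hq, h1, h2⟩ ⟨p', q', hq', h1', h2'⟩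
    refine ⟨p * q' + p' * q, q * q', by simp [hq, hq'], ?_, ?_⟩
    · rw [map_add, map_mul, map_mul, map_mul, ← h1, ← h1', Prod.fst_add]
      ring
    · rw [eval_add, eval_mul, eval_mul, eval_mul, ← h2, ← h2', Prod.snd_add]
      ring
  algebraMap_mem' r := ⟨Polynomial.C (r : K), 1, by simp, by simp, by simp⟩

theorem inv_mem_specializationGraph {x : RatFunc K} {y : K} (hy : y ≠ 0)
    (h : (x, y) ∈ specializationGraph K) : (x⁻¹, y⁻¹) ∈ specializationGraph K := by
  obtain ⟨p, q, hq, h1, h2⟩ := h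
  simp only at h1 h2
  have hp : p.eval 1 ≠ 0 := h2 ▸ mul_ne_zero hy hq
  have hp0 : algebraMap K[X] (RatFunc K) p ≠ 0 := by
    intro h0
    rw [map_eq_zero_iff _ (RatFunc.algebraMap_injective K)] at h0
    simp [h0] at hp
  have hx : x ≠ 0 := by
    rintro rfl
    exact hp0 (by rw [← h1, zero_mul])
  refine ⟨q, p, hp, ?_, ?_⟩
  · rw [← h1]
    exact inv_mul_cancel_left₀ hx _
  · rw [← h2]
    exact inv_mul_cancel_left₀ hy _

theorem specializationGraph_unique {x : RatFunc K} {y y' : K}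
    (h : (x, y) ∈ specializationGraph K) (h' : (x, y') ∈ specializationGraph K) : y = y' := by
  obtain ⟨p, q, hq, h1, h2⟩ := h
  obtain ⟨p', q', hq', h1', h2'⟩ := h'
  simp only at h1 h2 h1' h2'
  have h3 : p * q' = p' * q := by
    apply RatFunc.algebraMap_injective K
    rw [map_mul, map_mul, ← h1, ← h1']
    ring
  have h4 := congrArg (eval 1) h3
  rw [eval_mul, eval_mul, ← h2, ← h2'] at h4
  refine mul_right_cancel₀ (mul_ne_zero hq hq') ?_
  linear_combination h4

/-- If the variables of `b` specialize to units of the Laurent ring of `a`, then the Laurent ring of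
`b` specializes into that of `a`. -/
theorem exists_mem_specializationGraph {W V : Type*} {b : W → RatFunc K} {a : V → K}
    (hb : ∀ i, ∃ y ∈ laurentOn a Set.univ, y ≠ 0 ∧ y⁻¹ ∈ laurentOn a Set.univ ∧
      (b i, y) ∈ specializationGraph K) {x : RatFunc K} (hx : x ∈ laurentOn b Set.univ) :
    ∃ y ∈ laurentOn a Set.univ, (x, y) ∈ specializationGraph K := by
  induction hx using Algebra.adjoin_induction with
  | mem x hx =>
    rcases hx with ⟨i, -, rfl⟩ | ⟨i, -, rfl⟩
    · obtain ⟨y, h1, -, -, h2⟩ := hb i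
      exact ⟨y, h1, h2⟩
    · obtain ⟨y, -, h0, h1, h2⟩ := hb i
      exact ⟨y⁻¹, h1, inv_mem_specializationGraph h0 h2⟩
  | algebraMap r =>
    exact ⟨r, intCast_mem _ r, ⟨Polynomial.C (r : K), 1, by simp, by simp, by simp⟩⟩
  | add x x' _ _ ih ih' =>
    obtain ⟨y, h1, h2⟩ := ih
    obtain ⟨y', h1', h2'⟩ := ih'
    exact ⟨y + y', add_mem h1 h1', add_mem h2 h2'⟩
  | mul x x' _ _ ih ih' =>
    obtain ⟨y, h1, h2⟩ := ih
    obtain ⟨y', h1', h2'⟩ := ih'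
    exact ⟨y * y', mul_mem h1 h1', mul_mem h2 h2'⟩

end Specialization

section Extension

variable {V : Type u} {K : Type w} [DecidableEq V] [Field K]

/-- The quiver `q` with one more vertex `none`, and one arrow from `k` to it. -/
def IceQuiver.extend (q : IceQuiver V) (k : V) : IceQuiver (Option V) where
  Q
    | some i, some j => q.Q i j
    | some i, none => if i = k then 1 else 0
    | none, some j => if j = k then -1 else 0
    | none, none => 0
  skew := by
    rintro (_ | i) (_ | j)
    · rfl
    · dsimp only
      split_ifs <;> rfl
    · dsimp only
      split_ifs <;> rfl
    · exact q.skew i j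
  frozen := some '' q.frozen

/-- The cluster `a` with one more variable, the transcendental `z` of the field `K(z)`. -/
noncomputable def extendCluster (a : V → K) : Option V → RatFunc K
  | none => RatFunc.X
  | some v => algebraMap K (RatFunc K) (a v)

omit [DecidableEq V] in
theorem algebraicIndependent_extendCluster [Algebra ℚ K] {a : V → K}
    (ha : AlgebraicIndependent ℚ a) : AlgebraicIndependent ℚ (extendCluster a) := by
  have hX : AlgebraicIndependent K fun _ : Unit => (RatFunc.X : RatFunc K) := by
    rw [algebraicIndependent_unique_type_iff]
    exact RatFunc.transcendental_X
  have h := AlgebraicIndependent.sumElim_comp ha hX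
  let f : Option V → Unit ⊕ V := fun o => o.elim (Sum.inl ()) Sum.inr
  have hf : Function.Injective f := by
    rintro (_ | i) (_ | j) hij
    · rfl
    · cases hij
    · cases hij
    · exact congrArg some (Sum.inr.inj hij)
  convert h.comp f hf using 1
  funext o
  cases o <;> rfl

variable [Fintype V]

/-- The seed `(q', b)` on `Option V` specializes to the seed `(q, a)` at `z = 1`. -/
structure Specializes (q' : IceQuiver (Option V)) (b : Option V → RatFunc K) (q : IceQuiver V)
    (a : V → K) : Prop where
  quiver : ∀ i j, q'.Q (some i) (some j) = q.Q i j
  none : (b none, (1 : K)) ∈ specializationGraph K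
  some : ∀ v, (b (some v), a v) ∈ specializationGraph K

omit [Fintype V] in
theorem specializes_extend (q : IceQuiver V) (a : V → K) (k : V) :
    Specializes (q.extend k) (extendCluster a) q a where
  quiver _ _ := rfl
  none := ⟨X, 1, by simp, by simp [extendCluster], by simp⟩
  some v := ⟨Polynomial.C (a v), 1, by simp,
    by simp [extendCluster, RatFunc.algebraMap_eq_C], by simp⟩

theorem Specializes.mutate {q' : IceQuiver (Option V)} {b : Option V → RatFunc K}
    {q : IceQuiver V} {a : V → K} (h : Specializes q' b q a) {k : V} (hk : a k ≠ 0) :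
    Specializes (q'.mutate (Option.some k)) (mutateCluster q' b (Option.some k)) (q.mutate k)
      (mutateCluster q a k) := by
  have hprod : ∀ e : Option V → ℕ,
      (∏ v, b v ^ e v, ∏ v, a v ^ e (Option.some v)) ∈ specializationGraph K := by
    intro e
    have : (∏ v, b v ^ e v, ∏ v, a v ^ e (Option.some v))
        = (b Option.none, (1 : K)) ^ e Option.none *
          ∏ v, (b (Option.some v), a v) ^ e (Option.some v) := by
      apply Prod.ext
      · rw [Fintype.prod_option, Prod.fst_mul, Prod.fst_prod, Prod.pow_fst]
        rfl
      · rw [Prod.snd_mul, Prod.snd_prod, Prod.pow_snd, one_pow, one_mul]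
        rfl
    rw [this]
    exact mul_mem (pow_mem h.none _) (prod_mem fun v _ => pow_mem (h.some v) _)
  have hex : (exchange q' b (Option.some k), exchange q a k) ∈ specializationGraph K := by
    have h1 := add_mem (hprod fun v => (q'.Q (Option.some k) v).toNat)
      (hprod fun v => (-q'.Q (Option.some k) v).toNat)
    simp only [h.quiver, Prod.mk_add_mk] at h1
    exact h1
  refine ⟨fun i j => ?_, ?_, fun v => ?_⟩
  · simp only [IceQuiver.mutate, h.quiver, Option.some.injEq]
  · rw [mutateCluster_of_ne q' b (Option.some_ne_none k).symm]
    exact h.none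
  · by_cases hv : v = k
    · subst hv
      rw [mutateCluster_self, mutateCluster_self]
      exact mul_mem hex (inv_mem_specializationGraph hk (h.some v))
    · rw [mutateCluster_of_ne q a hv, mutateCluster_of_ne q' b (by simpa using hv)]
      exact h.some v

theorem Specializes.mutateWord [Algebra ℚ K] {q' : IceQuiver (Option V)}
    {b : Option V → RatFunc K} {q : IceQuiver V} {a : V → K} (h : Specializes q' b q a)
    (ha : AlgebraicIndependent ℚ a) (l : List V) (v : V) :
    (mutateWord q' b (l.map Option.some) (Option.some v), mutateWord q a l v) ∈
      specializationGraph K := by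
  induction l generalizing q' b q a with
  | nil => exact h.some v
  | cons k l ih =>
    exact ih (h.mutate (ha.ne_zero k)) (algebraicIndependent_mutateCluster ha q k)

omit [DecidableEq V] [Fintype V] in
theorem Specializes.mem_laurentOn {q' : IceQuiver (Option V)} {b : Option V → RatFunc K}
    {q : IceQuiver V} {a : V → K} (h : Specializes q' b q a) (ha : ∀ v, a v ≠ 0)
    {x : RatFunc K} {y : K} (hxy : (x, y) ∈ specializationGraph K)
    (hx : x ∈ laurentOn b Set.univ) : y ∈ laurentOn a Set.univ := by
  obtain ⟨y', h1, h2⟩ := exists_mem_specializationGraph (a := a) (b := b) (by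
    rintro (_ | v)
    · exact ⟨1, one_mem _, one_ne_zero, by simp, h.none⟩
    · exact ⟨a v, ClusterAlg.mem_laurentOn a (Set.mem_univ v), ha v,
        inv_mem_laurentOn a (Set.mem_univ v), h.some v⟩) hx
  rwa [specializationGraph_unique hxy h2]

end Extension

/-- The Laurent phenomenon for words of length `m`. All vertex sets and fields are considered at
once, because the induction on `m` adds a vertex and a variable. -/
def LaurentPhenomenon (m : ℕ) : Prop :=
  ∀ (V : Type u) (K : Type w) [Fintype V] [DecidableEq V] [Field K] [Algebra ℚ K]
    (q : IceQuiver V) (a : V → K), AlgebraicIndependent ℚ a → ∀ l : List V, l.length = m →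
      ∀ v, mutateWord q a l v ∈ laurentOn a Set.univ

variable {V : Type u} {K : Type w} [Fintype V] [DecidableEq V] [Field K] [Algebra ℚ K]

theorem mutateCluster_mutateCluster_of_independent (q : IceQuiver V) {a : V → K}
    (ha : AlgebraicIndependent ℚ a) (k : V) :
    mutateCluster (q.mutate k) (mutateCluster q a k) k = a :=
  mutateCluster_mutateCluster (ha.ne_zero k) (exchange_ne_zero ha q k)

theorem mutateWord_cons_mutate (q : IceQuiver V) {a : V → K} (ha : AlgebraicIndependent ℚ a)
    (k : V) (l : List V) :
    mutateWord (q.mutate k) (mutateCluster q a k) (k :: l) = mutateWord q a l := by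
  rw [mutateWord, mutateCluster_mutateCluster_of_independent q ha, q.mutate_mutate]

theorem LaurentPhenomenon.mem_mutateCluster {m : ℕ}
    (h : LaurentPhenomenon.{u, w} (m + 1)) (q : IceQuiver V) {a : V → K}
    (ha : AlgebraicIndependent ℚ a) (k : V) {l : List V} (hl : l.length = m) (v : V) :
    mutateWord q a l v ∈ laurentOn (mutateCluster q a k) Set.univ := by
  rw [← mutateWord_cons_mutate q ha k l]
  exact h V K _ _ (algebraicIndependent_mutateCluster ha q k) _ (by simp [hl]) v

/-- If the Laurent phenomenon holds for words of length `m` and `m + 1`, then the variables of a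
cluster at distance `m` from a seed are Laurent polynomials in the clusters at distance two
from it. -/
theorem LaurentPhenomenon.mem_mutateCluster_mutateCluster {m : ℕ}
    (h0 : LaurentPhenomenon.{u, w} m) (h1 : LaurentPhenomenon.{u, w} (m + 1)) (q : IceQuiver V)
    {a : V → K} (ha : AlgebraicIndependent ℚ a) {j k : V} (hjk : j ≠ k) {l : List V}
    (hl : l.length = m) (v : V) :
    mutateWord q a l v ∈
      laurentOn (mutateCluster (q.mutate k) (mutateCluster q a k) j) Set.univ := by
  by_cases hc : q.Q j k = 0
  · have hs := specializes_extend q a k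
    have hb := algebraicIndependent_extendCluster ha
    have hl' : (l.map some).length = m := by rw [List.length_map, hl]
    have ha₁ := algebraicIndependent_mutateCluster ha q k
    have hs₂ := (hs.mutate (ha.ne_zero k)).mutate (ha₁.ne_zero j)
    refine hs₂.mem_laurentOn (algebraicIndependent_mutateCluster ha₁ _ j).ne_zero
      (hs.mutateWord ha l v) ?_
    exact mem_laurentOn_of_eq_zero hb (q.extend k) (j := some j) (k := some k) (z := none)
      (by simpa using hjk)
      hc (by simp [IceQuiver.extend]) (by simp [IceQuiver.extend, hjk])
      (h1.mem_mutateCluster _ hb (some j) hl' (some v))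
      (h1.mem_mutateCluster _ hb (some k) hl' (some v))
  · exact mem_laurentOn_of_ne_zero ha q hjk hc (h0 V K q a ha l hl v)
      (h1.mem_mutateCluster q ha j hl v) (h1.mem_mutateCluster q ha k hl v)

theorem laurentPhenomenon (m : ℕ) : LaurentPhenomenon.{u, w} m := by
  induction m using Nat.strong_induction_on with
  | _ m ih =>
    intro V K _ _ _ _ q a ha l hl v
    match l, hl with
    | [], _ => exact mem_laurentOn a (Set.mem_univ v)
    | [k], _ =>
      change mutateCluster q a k v ∈ _
      by_cases hv : v = k
      · subst hv
        rw [mutateCluster_self]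
        exact mul_mem (exchange_mem fun j _ => mem_laurentOn a (Set.mem_univ j))
          (inv_mem_laurentOn a (Set.mem_univ v))
      · rw [mutateCluster_of_ne q a hv]
        exact mem_laurentOn a (Set.mem_univ v)
    | k :: j :: l, hl =>
      have ha₁ := algebraicIndependent_mutateCluster ha q k
      have ha₂ := algebraicIndependent_mutateCluster ha₁ (q.mutate k) j
      simp only [List.length_cons] at hl
      by_cases hjk : j = k
      · subst hjk
        rw [mutateWord, mutateWord_cons_mutate q ha]
        exact ih l.length (by omega) V K q a ha l rfl v
      · have h := (ih l.length (by omega)).mem_mutateCluster_mutateCluster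
          (ih (l.length + 1) (by omega)) ((q.mutate k).mutate j) ha₂ (Ne.symm hjk) rfl v
        rw [IceQuiver.mutate_mutate, mutateCluster_mutateCluster_of_independent _ ha₁,
          mutateCluster_mutateCluster_of_independent _ ha] at h
        exact h

end Laurent

end ClusterAlg

/-! ### Cluster algebras in a field and the acyclic case -/

namespace ClusterAlg

/-- A seed with values in an arbitrary field `K`. The arguments are carried out for these, since the
field of rational functions plays no role beyond containing the cluster. -/
structure FieldSeed (V K : Type*) where
  /-- the ice quiver -/
  quiver : IceQuiver V
  /-- the cluster -/
  cluster : V → K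

namespace FieldSeed

variable {V K : Type*}

/-- The freezing of a seed at the vertices in `F`. -/
def freeze (s : FieldSeed V K) (F : Set V) : FieldSeed V K where
  quiver := s.quiver.freeze F
  cluster := s.cluster

variable [Field K] [Fintype V] [DecidableEq V]

/-- Mutation of a seed at `k`. -/
noncomputable def mutate (s : FieldSeed V K) (k : V) : FieldSeed V K where
  quiver := s.quiver.mutate k
  cluster := mutateCluster s.quiver s.cluster k

/-- `t` is obtained from `s` by one mutation at a mutable vertex. -/
def MutStep (s t : FieldSeed V K) : Prop :=
  ∃ k, k ∉ s.quiver.frozen ∧ t = s.mutate k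

/-- `t` is obtained from `s` by a finite sequence of mutations at mutable vertices. -/
def MutEquiv (s t : FieldSeed V K) : Prop :=
  Relation.ReflTransGen MutStep s t

/-- The cluster algebra of `s`. -/
noncomputable def clusterAlgebra (s : FieldSeed V K) : Subalgebra ℤ K :=
  Algebra.adjoin ℤ ({x | ∃ t, s.MutEquiv t ∧ ∃ v, x = t.cluster v} ∪
    (fun v => (s.cluster v)⁻¹) '' s.quiver.frozen)

/-- The upper cluster algebra of `s`. -/
noncomputable def upperClusterAlgebra (s : FieldSeed V K) : Subalgebra ℤ K :=
  ⨅ (t : FieldSeed V K) (_ : s.MutEquiv t), laurentOn t.cluster Set.univ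

/-- The cluster algebra of `s` has an acyclic seed. -/
def IsAcyclic (s : FieldSeed V K) : Prop :=
  ∃ t, s.MutEquiv t ∧ t.quiver.IsAcyclic

theorem mutEquiv_mutate {s : FieldSeed V K} {k : V} (hk : k ∉ s.quiver.frozen) :
    s.MutEquiv (s.mutate k) :=
  Relation.ReflTransGen.single ⟨k, hk, rfl⟩

theorem MutEquiv.algebraicIndependent [Algebra ℚ K] {s t : FieldSeed V K} (h : s.MutEquiv t)
    (hs : AlgebraicIndependent ℚ s.cluster) : AlgebraicIndependent ℚ t.cluster := by
  induction h with
  | refl => exact hs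
  | tail _ h ih =>
    obtain ⟨k, _, rfl⟩ := h
    exact algebraicIndependent_mutateCluster ih _ k

theorem MutEquiv.frozen_eq {s t : FieldSeed V K} (h : s.MutEquiv t) :
    t.quiver.frozen = s.quiver.frozen := by
  induction h with
  | refl => rfl
  | tail _ h ih =>
    obtain ⟨k, _, rfl⟩ := h
    exact ih

theorem MutEquiv.cluster_eq {s t : FieldSeed V K} (h : s.MutEquiv t) {v : V}
    (hv : v ∈ s.quiver.frozen) : t.cluster v = s.cluster v := by
  induction h with
  | refl => rfl
  | tail h' h ih =>
    obtain ⟨k, hk, rfl⟩ := h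
    rw [← ih]
    refine mutateCluster_of_ne _ _ ?_
    rintro rfl
    exact hk (MutEquiv.frozen_eq h' ▸ hv)

theorem mutate_mutate [Algebra ℚ K] {s : FieldSeed V K}
    (hs : AlgebraicIndependent ℚ s.cluster) (k : V) : (s.mutate k).mutate k = s := by
  have h1 : ((s.mutate k).mutate k).quiver = s.quiver := s.quiver.mutate_mutate k
  have h2 : ((s.mutate k).mutate k).cluster = s.cluster :=
    mutateCluster_mutateCluster_of_independent s.quiver hs k
  obtain ⟨q, a⟩ := s
  exact congrArg₂ FieldSeed.mk h1 h2

theorem MutEquiv.symm [Algebra ℚ K] {s t : FieldSeed V K} (h : s.MutEquiv t)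
    (hs : AlgebraicIndependent ℚ s.cluster) : t.MutEquiv s := by
  induction h with
  | refl => exact Relation.ReflTransGen.refl
  | tail h' h ih =>
    obtain ⟨k, hk, rfl⟩ := h
    exact Relation.ReflTransGen.head ⟨k, hk, (mutate_mutate (MutEquiv.algebraicIndependent h' hs)
      k).symm⟩ ih

theorem MutEquiv.exists_mutateWord {s t : FieldSeed V K} (h : s.MutEquiv t) :
    ∃ l : List V, t.cluster = mutateWord s.quiver s.cluster l := by
  induction h using Relation.ReflTransGen.head_induction_on with
  | refl => exact ⟨[], rfl⟩
  | head h _ ih =>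
    obtain ⟨k, _, rfl⟩ := h
    obtain ⟨l, hl⟩ := ih
    exact ⟨k :: l, hl⟩

/-- The Laurent phenomenon. -/
theorem clusterAlgebra_le_upperClusterAlgebra [Algebra ℚ K] {s : FieldSeed V K}
    (hs : AlgebraicIndependent ℚ s.cluster) : s.clusterAlgebra ≤ s.upperClusterAlgebra := by
  refine le_iInf₂ fun r hr => Algebra.adjoin_le ?_
  rintro _ (⟨t, ht, v, rfl⟩ | ⟨v, hv, rfl⟩)
  · obtain ⟨l, hl⟩ := MutEquiv.exists_mutateWord ((hr.symm hs).trans ht)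
    rw [hl]
    exact laurentPhenomenon _ _ _ _ _ (hr.algebraicIndependent hs) l rfl v
  · simp only [← hr.cluster_eq hv]
    exact inv_mem_laurentOn _ (Set.mem_univ v)

theorem cluster_mem_clusterAlgebra {s t : FieldSeed V K} (h : s.MutEquiv t) (v : V) :
    t.cluster v ∈ s.clusterAlgebra :=
  Algebra.subset_adjoin (Or.inl ⟨t, h, v, rfl⟩)

theorem inv_mem_clusterAlgebra (s : FieldSeed V K) {v : V} (hv : v ∈ s.quiver.frozen) :
    (s.cluster v)⁻¹ ∈ s.clusterAlgebra :=
  Algebra.subset_adjoin (Or.inr ⟨v, hv, rfl⟩)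

theorem MutEquiv.clusterAlgebra_le {s t : FieldSeed V K} (h : s.MutEquiv t) :
    t.clusterAlgebra ≤ s.clusterAlgebra := by
  refine Algebra.adjoin_le ?_
  rintro _ (⟨r, hr, v, rfl⟩ | ⟨v, hv, rfl⟩)
  · exact cluster_mem_clusterAlgebra (h.trans hr) v
  · rw [h.frozen_eq] at hv
    simp only [h.cluster_eq hv]
    exact inv_mem_clusterAlgebra s hv

theorem MutEquiv.upperClusterAlgebra_le {s t : FieldSeed V K} (h : s.MutEquiv t) :
    s.upperClusterAlgebra ≤ t.upperClusterAlgebra :=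
  le_iInf₂ fun r hr => iInf₂_le r (h.trans hr)

theorem MutEquiv.of_freeze {s r : FieldSeed V K} {F : Set V} (h : (s.freeze F).MutEquiv r) :
    ∃ t, s.MutEquiv t ∧ r = t.freeze F := by
  induction h with
  | refl => exact ⟨s, Relation.ReflTransGen.refl, rfl⟩
  | tail _ h ih =>
    obtain ⟨k, hk, rfl⟩ := h
    obtain ⟨t, ht, rfl⟩ := ih
    exact ⟨t.mutate k, ht.tail ⟨k, fun hk' => hk (Or.inl hk'), rfl⟩, rfl⟩

theorem upperClusterAlgebra_le_freeze (s : FieldSeed V K) (F : Set V) :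
    s.upperClusterAlgebra ≤ (s.freeze F).upperClusterAlgebra := by
  refine le_iInf₂ fun r hr => ?_
  obtain ⟨t, ht, rfl⟩ := hr.of_freeze
  exact iInf₂_le t ht

/-- The cluster algebra of the freezing at `F` is contained in the localization of the cluster
algebra at a common multiple of the variables in `F`. -/
theorem exists_pow_mul_mem_of_mem_freeze {s : FieldSeed V K} {F : Set V} {y u : K}
    (hy : y ∈ s.clusterAlgebra) (hF : ∀ v ∈ F, y * (s.cluster v)⁻¹ ∈ s.clusterAlgebra)
    (hu : u ∈ (s.freeze F).clusterAlgebra) : ∃ N : ℕ, y ^ N * u ∈ s.clusterAlgebra := by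
  refine exists_pow_mul_mem_of_mem_adjoin hy ?_ hu
  rintro _ (⟨r, hr, v, rfl⟩ | ⟨v, hv | hv, rfl⟩)
  · obtain ⟨t, ht, rfl⟩ := hr.of_freeze
    exact ⟨0, by simpa using! cluster_mem_clusterAlgebra ht v⟩
  · exact ⟨0, by simpa using! inv_mem_clusterAlgebra s hv⟩
  · exact ⟨1, by simpa using! hF v hv⟩

section Acyclic

/-- The subring generated by the variables of the seed and of the adjacent seeds, and the inverses
of the frozen variables (the lower bound of the cluster algebra). -/
noncomputable def lowerBound (s : FieldSeed V K) : Subalgebra ℤ K :=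
  Algebra.adjoin ℤ ({x | ∃ v, x = s.cluster v} ∪ {x | ∃ v ∈ s.quiver.frozen, x = (s.cluster v)⁻¹} ∪
    {x | ∃ v, v ∉ s.quiver.frozen ∧ x = (s.mutate v).cluster v})

theorem lowerBound_le_clusterAlgebra (s : FieldSeed V K) : s.lowerBound ≤ s.clusterAlgebra := by
  refine Algebra.adjoin_le ?_
  rintro _ ((⟨v, rfl⟩ | ⟨v, hv, rfl⟩) | ⟨v, hv, rfl⟩)
  · exact cluster_mem_clusterAlgebra Relation.ReflTransGen.refl v
  · exact inv_mem_clusterAlgebra s hv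
  · exact cluster_mem_clusterAlgebra (mutEquiv_mutate hv) v

/-- The subring generated by the generators of the lower bound that do not belong to `k`. -/
noncomputable def lowerBoundAway (s : FieldSeed V K) (k : V) : Subalgebra ℤ K :=
  Algebra.adjoin ℤ ({x | ∃ v ≠ k, x = s.cluster v} ∪
    {x | ∃ v ∈ s.quiver.frozen, v ≠ k ∧ x = (s.cluster v)⁻¹} ∪
    {x | ∃ v ∉ s.quiver.frozen, v ≠ k ∧ x = (s.mutate v).cluster v})

/-- A seed without arrows between mutable vertices. -/
def IsIsolated (s : FieldSeed V K) : Prop :=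
  ∀ i ∉ s.quiver.frozen, ∀ j ∉ s.quiver.frozen, s.quiver.Q i j = 0

omit [Field K] [Fintype V] [DecidableEq V] in
theorem IsIsolated.freeze {s : FieldSeed V K} (h : s.IsIsolated) (F : Set V) :
    (s.freeze F).IsIsolated := fun i hi j hj => h i (fun hi' => hi (Or.inl hi')) j fun hj' => hj (Or.inl hj')

theorem IsIsolated.mutate {s : FieldSeed V K} (h : s.IsIsolated) {k : V}
    (hk : k ∉ s.quiver.frozen) : (s.mutate k).IsIsolated := by
  intro i hi j hj
  change (s.quiver.mutate k).Q i j = 0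
  by_cases hik : i = k
  · subst hik
    rw [IceQuiver.mutate_Q_left, h i hk j hj, neg_zero]
  by_cases hjk : j = k
  · subst hjk
    rw [IceQuiver.mutate_Q_right, h i hi j hk, neg_zero]
  · rw [IceQuiver.mutate_Q_of_ne _ hik hjk, h i hi j hj, h i hi k hk, h k hk j hj]
    rfl

theorem lowerBound_freeze_le (s : FieldSeed V K) (k : V) :
    (s.freeze {k}).lowerBound ≤ Algebra.adjoin ℤ ((s.lowerBoundAway k : Set K) ∪
      {s.cluster k, (s.cluster k)⁻¹}) := by
  refine Algebra.adjoin_le ?_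
  rintro _ ((⟨v, rfl⟩ | ⟨v, hv, rfl⟩) | ⟨v, hv, rfl⟩) <;> apply Algebra.subset_adjoin
  · by_cases hvk : v = k
    · subst hvk
      exact Or.inr (Or.inl rfl)
    · exact Or.inl (Algebra.subset_adjoin (Or.inl (Or.inl ⟨v, hvk, rfl⟩)))
  · by_cases hvk : v = k
    · subst hvk
      exact Or.inr (Or.inr rfl)
    · exact Or.inl (Algebra.subset_adjoin (Or.inl (Or.inr ⟨v, hv.resolve_right hvk, hvk, rfl⟩)))
  · exact Or.inl (Algebra.subset_adjoin (Or.inr ⟨v, fun hv' => hv (Or.inl hv'),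
      fun hvk => hv (Or.inr hvk), rfl⟩))

theorem IsIsolated.lowerBoundAway_mutate_le {s : FieldSeed V K} (h : s.IsIsolated) {k : V}
    (hk : k ∉ s.quiver.frozen) : (s.mutate k).lowerBoundAway k ≤ s.lowerBoundAway k := by
  refine Algebra.adjoin_le ?_
  rintro _ ((⟨v, hv, rfl⟩ | ⟨v, hv, hvk, rfl⟩) | ⟨v, hv, hvk, rfl⟩) <;>
    apply Algebra.subset_adjoin
  · exact Or.inl (Or.inl ⟨v, hv, mutateCluster_of_ne _ _ hv⟩)
  · exact Or.inl (Or.inr ⟨v, hv, hvk, congrArg _ (mutateCluster_of_ne _ _ hvk)⟩)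
  · refine Or.inr ⟨v, hv, hvk, ?_⟩
    change mutateCluster (s.quiver.mutate k) (mutateCluster s.quiver s.cluster k) v v
      = mutateCluster s.quiver s.cluster v v
    rw [mutateCluster_self, exchange_mutate_of_eq_zero _ _ hvk (h v hv k hk),
      mutateCluster_of_ne _ _ hvk, mutateCluster_self]

theorem IsIsolated.transcendental [Algebra ℚ K] {s : FieldSeed V K} (h : s.IsIsolated)
    (hs : AlgebraicIndependent ℚ s.cluster) {k : V} (hk : k ∉ s.quiver.frozen) :
    Transcendental (s.lowerBoundAway k) (s.cluster k) := by
  refine transcendental_of_forall_mem_adjoin hs fun c hc => ?_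
  let F := IntermediateField.adjoin ℚ (s.cluster '' {k}ᶜ)
  have hF : ∀ v, v ≠ k → s.cluster v ∈ F := fun v hv =>
    IntermediateField.subset_adjoin _ _ ⟨v, hv, rfl⟩
  let E : Subalgebra ℤ K :=
    { carrier := F
      mul_mem' := mul_mem
      add_mem' := add_mem
      algebraMap_mem' := fun r => by simp }
  suffices hE : s.lowerBoundAway k ≤ E from hE hc
  refine Algebra.adjoin_le ?_
  rintro _ ((⟨v, hv, rfl⟩ | ⟨v, hv, hvk, rfl⟩) | ⟨v, hv, hvk, rfl⟩)
  · exact hF v hv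
  · exact inv_mem (S := IntermediateField ℚ K) (hF v hvk)
  · have h1 : exchange s.quiver s.cluster v ∈ E := exchange_mem fun j hj => hF j (by
      rintro rfl
      exact hj (h v hv j hk))
    have h2 : mutateCluster s.quiver s.cluster v v ∈ F := by
      rw [mutateCluster_self]
      exact mul_mem (show _ ∈ F from h1) (inv_mem (hF v hvk))
    exact h2

/-- The induction runs over the mutable vertices: freezing `k`, before and after mutation at `k`,
shows that an element of the upper cluster algebra is a Laurent polynomial both in `a_k` and in
`a_k'` over the generators that do not involve `k`. -/
theorem IsIsolated.upperClusterAlgebra_le_lowerBound [Algebra ℚ K] {s : FieldSeed V K}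
    (h : s.IsIsolated) (hs : AlgebraicIndependent ℚ s.cluster) :
    s.upperClusterAlgebra ≤ s.lowerBound := by
  induction hn : (s.quiver.frozenᶜ).ncard using Nat.strong_induction_on generalizing s with
  | _ n ih =>
  by_cases hfrozen : ∀ k, k ∈ s.quiver.frozen
  · refine (iInf₂_le s Relation.ReflTransGen.refl).trans ?_
    exact laurentOn_le (fun v _ => Algebra.subset_adjoin (Or.inl (Or.inl ⟨v, rfl⟩)))
      fun v _ => Algebra.subset_adjoin (Or.inl (Or.inr ⟨v, hfrozen v, rfl⟩))
  push Not at hfrozen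
  obtain ⟨k, hk⟩ := hfrozen
  have hcard : ((s.quiver.frozen ∪ {k})ᶜ).ncard < n := by
    rw [← hn]
    refine Set.ncard_lt_ncard ⟨Set.compl_subset_compl.mpr Set.subset_union_left, fun hle => ?_⟩
      (Set.toFinite _)
    exact hle hk (Or.inr rfl)
  intro u hu
  have hs' : AlgebraicIndependent ℚ (s.mutate k).cluster :=
    (mutEquiv_mutate hk).algebraicIndependent hs
  have h1 := lowerBound_freeze_le s k
    (ih _ hcard (h.freeze {k}) hs rfl (upperClusterAlgebra_le_freeze s {k} hu))
  have h2 := lowerBound_freeze_le (s.mutate k) k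
    (ih _ hcard ((h.mutate hk).freeze {k}) hs' rfl
      (upperClusterAlgebra_le_freeze _ {k} ((mutEquiv_mutate hk).upperClusterAlgebra_le hu)))
  have h3 := Algebra.adjoin_mono (R := ℤ) (Set.union_subset_union_left
    {(s.mutate k).cluster k, ((s.mutate k).cluster k)⁻¹} (h.lowerBoundAway_mutate_le hk)) h2
  have hP : exchange s.quiver s.cluster k ∈ s.lowerBoundAway k := exchange_mem fun j hj =>
    Algebra.subset_adjoin (Or.inl (Or.inl ⟨j, (by
      rintro rfl
      exact hj (s.quiver.Q_self _)), rfl⟩))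
  have h4 := mem_adjoin_of_mem_adjoin_inv (s.lowerBoundAway k) (h.transcendental hs hk) hP
    (exchange_ne_zero hs _ k) (self_mul_mutateCluster_self s.quiver (hs.ne_zero k)) h1 h3
  refine Algebra.adjoin_le ?_ h4
  rintro x (hx | rfl | rfl)
  · refine Algebra.adjoin_mono ?_ hx
    rintro _ ((⟨v, hv, rfl⟩ | ⟨v, hv, hvk, rfl⟩) | ⟨v, hv, hvk, rfl⟩)
    exacts [Or.inl (Or.inl ⟨v, rfl⟩), Or.inl (Or.inr ⟨v, hv, rfl⟩), Or.inr ⟨v, hv, rfl⟩]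
  · exact Algebra.subset_adjoin (Or.inl (Or.inl ⟨k, rfl⟩))
  · exact Algebra.subset_adjoin (Or.inr ⟨k, hk, rfl⟩)

omit [Fintype V] [DecidableEq V] in
theorem _root_.ClusterAlg.IceQuiver.IsAcyclic.freeze {q : IceQuiver V} (h : q.IsAcyclic)
    (F : Set V) : (q.freeze F).IsAcyclic := fun i hi =>
  h i (Relation.TransGen.mono (fun _ _ hab => ⟨fun ha => hab.1 (Or.inl ha),
    fun hb => hab.2.1 (Or.inl hb), hab.2.2⟩) i i hi)

omit [Fintype V] [DecidableEq V] in
/-- An acyclic quiver with an arrow between mutable vertices has one that starts at a source of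
its mutable part. -/
theorem _root_.ClusterAlg.IceQuiver.IsAcyclic.exists_source [Finite V] {q : IceQuiver V}
    (h : q.IsAcyclic) {i j : V} (hij : q.MutArrow i j) :
    ∃ i j, q.MutArrow i j ∧ ∀ l, ¬ q.MutArrow l i := by
  have : Std.Irrefl (Relation.TransGen q.MutArrow) := ⟨h⟩
  have hwf : WellFounded (Relation.TransGen q.MutArrow) :=
    Finite.wellFounded_of_trans_of_irrefl _
  obtain ⟨i, ⟨j, hij⟩, hmin⟩ := hwf.has_min {i | ∃ j, q.MutArrow i j} ⟨i, j, hij⟩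
  exact ⟨i, j, hij, fun l hl => hmin l ⟨i, hl⟩ (Relation.TransGen.single hl)⟩

/-- `A = U` for a seed with an acyclic quiver. A source `i` of the mutable part and the target `j`
of an arrow `i → j` give two variables without common zero; freezing either of them leaves fewer
mutable vertices. -/
theorem upperClusterAlgebra_le_of_isAcyclic [Algebra ℚ K] {s : FieldSeed V K}
    (hs : AlgebraicIndependent ℚ s.cluster) (h : s.quiver.IsAcyclic) :
    s.upperClusterAlgebra ≤ s.clusterAlgebra := by
  induction hn : (s.quiver.frozenᶜ).ncard using Nat.strong_induction_on generalizing s with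
  | _ n ih =>
  by_cases harrow : ∃ i j, s.quiver.MutArrow i j
  · obtain ⟨i₀, j₀, hij₀⟩ := harrow
    obtain ⟨i, j, ⟨hi, hj, hij⟩, hsource⟩ := h.exists_source hij₀
    intro u hu
    have hmem : ∀ v, s.cluster v ∈ s.clusterAlgebra :=
      cluster_mem_clusterAlgebra Relation.ReflTransGen.refl
    have hloc : ∀ k ∉ s.quiver.frozen, ∃ N : ℕ, s.cluster k ^ N * u ∈ s.clusterAlgebra := by
      intro k hk
      have hcard : ((s.quiver.frozen ∪ {k})ᶜ).ncard < n := by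
        rw [← hn]
        refine Set.ncard_lt_ncard ⟨Set.compl_subset_compl.mpr Set.subset_union_left,
          fun hle => ?_⟩ (Set.toFinite _)
        exact hle hk (Or.inr rfl)
      refine exists_pow_mul_mem_of_mem_freeze (F := {k}) (hmem k) ?_
        (ih _ hcard (s := s.freeze {k}) hs (h.freeze {k}) rfl
          (upperClusterAlgebra_le_freeze s {k} hu))
      rintro v rfl
      rw [mul_inv_cancel₀ (hs.ne_zero v)]
      exact one_mem _
    obtain ⟨a, ha, b, hb, hab⟩ := exists_mul_add_mul_eq_one_of_pos hs.ne_zero s.quiver hij hmem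
      (fun v hv => inv_mem_clusterAlgebra s (by
        by_contra hv'
        refine hsource v ⟨hv', hi, ?_⟩
        rw [s.quiver.skew]
        omega)) (cluster_mem_clusterAlgebra (mutEquiv_mutate hi) i)
    exact mem_of_pow_mul_mem_of_add_eq_one (hmem i) (hmem j) ha hb hab (hloc i hi) (hloc j hj)
  · push Not at harrow
    have hiso : s.IsIsolated := by
      intro i hi j hj
      have h1 : ¬ 0 < s.quiver.Q i j := fun h0 => harrow i j ⟨hi, hj, h0⟩
      have h2 : ¬ 0 < s.quiver.Q j i := fun h0 => harrow j i ⟨hj, hi, h0⟩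
      rw [s.quiver.skew j i] at h2
      omega
    exact (hiso.upperClusterAlgebra_le_lowerBound hs).trans s.lowerBound_le_clusterAlgebra

theorem IsAcyclic.upperClusterAlgebra_le [Algebra ℚ K] {s : FieldSeed V K} (h : s.IsAcyclic)
    (hs : AlgebraicIndependent ℚ s.cluster) : s.upperClusterAlgebra ≤ s.clusterAlgebra := by
  obtain ⟨t, ht, hacyclic⟩ := h
  exact ht.upperClusterAlgebra_le.trans ((upperClusterAlgebra_le_of_isAcyclic
    (ht.algebraicIndependent hs) hacyclic).trans ht.clusterAlgebra_le)

end Acyclic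

/-- On an acyclic cluster chart, an element of the upper cluster algebra is a fraction whose
denominator is invertible. -/
theorem exists_mul_mem_of_isAcyclic_freeze [Algebra ℚ K] {s t : FieldSeed V K}
    (hs : AlgebraicIndependent ℚ s.cluster) (ht : s.MutEquiv t) {F : Set V}
    (hF : (t.freeze F).IsAcyclic) {u : K} (hu : u ∈ s.upperClusterAlgebra) :
    ∃ y ∈ s.clusterAlgebra, y ≠ 0 ∧ y⁻¹ ∈ (t.freeze F).clusterAlgebra ∧
      y * u ∈ s.clusterAlgebra := by
  classical
  have hti := ht.algebraicIndependent hs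
  have hcl : ∀ v, t.cluster v ∈ t.clusterAlgebra :=
    cluster_mem_clusterAlgebra Relation.ReflTransGen.refl
  have hut : u ∈ (t.freeze F).clusterAlgebra := hF.upperClusterAlgebra_le hti
    (upperClusterAlgebra_le_freeze t F (ht.upperClusterAlgebra_le hu))
  set y := ∏ v ∈ Finset.univ.filter (· ∈ F), t.cluster v with hy
  have hyt : y ∈ t.clusterAlgebra := prod_mem fun v _ => hcl v
  obtain ⟨N, hN⟩ := exists_pow_mul_mem_of_mem_freeze (F := F) hyt (fun v hv => by
    rw [hy, ← Finset.mul_prod_erase _ _ (Finset.mem_filter.mpr ⟨Finset.mem_univ v, hv⟩),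
      mul_right_comm, mul_inv_cancel₀ (hti.ne_zero v), one_mul]
    exact prod_mem fun v _ => hcl v) hut
  refine ⟨y ^ N, ht.clusterAlgebra_le (pow_mem hyt N),
    pow_ne_zero _ (Finset.prod_ne_zero_iff.mpr fun v _ => hti.ne_zero v), ?_,
    ht.clusterAlgebra_le hN⟩
  rw [← inv_pow, hy, ← Finset.prod_inv_distrib]
  exact pow_mem (prod_mem fun v hv =>
    inv_mem_clusterAlgebra (t.freeze F) (Or.inr (Finset.mem_filter.mp hv).2)) N

end FieldSeed

end ClusterAlg

/-! ### Spectra and the field of rational functions -/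

namespace ClusterAlg

section Spectrum

variable {A : Type*} [CommRing A] [Algebra ℤ A]

/-- An element that is a section of the structure sheaf near every point lies in the ring: its
ideal of denominators is contained in no maximal ideal. -/
theorem mem_of_forall_primeSpectrum (E : Subalgebra ℤ A) {u : A}
    (h : ∀ P : PrimeSpectrum E, ∃ y : E, y ∉ P.asIdeal ∧ (y : A) * u ∈ E) : u ∈ E := by
  let I : Ideal E :=
    { carrier := {y | (y : A) * u ∈ E}
      zero_mem' := by simp
      add_mem' := fun {x y} hx hy => by
        simpa [add_mul] using! add_mem (S := Subalgebra ℤ A) hx hy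
      smul_mem' := fun c x hx => by
        simpa [mul_assoc] using! mul_mem (S := Subalgebra ℤ A) c.2 hx }
  have hI : I = ⊤ := by
    by_contra hI
    obtain ⟨m, hm, hIm⟩ := I.exists_le_maximal hI
    obtain ⟨y, hy, hyu⟩ := h ⟨m, hm.isPrime⟩
    exact hy (hIm hyu)
  have h1 : (1 : E) ∈ I := hI ▸ Submodule.mem_top
  have h2 : ((1 : E) : A) * u ∈ E := h1
  rwa [OneMemClass.coe_one, one_mul] at h2

theorem notMem_of_mem_range_comap {E E' : Subalgebra ℤ A} (h : E ≤ E') {P : PrimeSpectrum E}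
    (hP : P ∈ Set.range (PrimeSpectrum.comap (Subalgebra.inclusion h).toRingHom)) {y z : A}
    (hy : y ∈ E) (hz : z ∈ E') (hyz : z * y = 1) : (⟨y, hy⟩ : E) ∉ P.asIdeal := by
  obtain ⟨P', rfl⟩ := hP
  intro hmem
  have hmem' : (⟨y, h hy⟩ : E') ∈ P'.asIdeal := hmem
  refine P'.isPrime.ne_top ((Ideal.eq_top_iff_one _).mpr ?_)
  have h1 := P'.asIdeal.mul_mem_left ⟨z, hz⟩ hmem'
  have h2 : (⟨z, hz⟩ * ⟨y, h hy⟩ : E') = 1 := Subtype.ext hyz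
  rwa [h2] at h1

end Spectrum

section Comparison

theorem algebraicIndependent_rat_congr {ι A : Type*} [CommRing A] (i j : Algebra ℚ A) {x : ι → A}
    (h : @AlgebraicIndependent ι ℚ A x _ _ i) : @AlgebraicIndependent ι ℚ A x _ _ j := by
  rwa [Subsingleton.elim j i]


variable {V : Type*}

/-- A seed as a seed with values in the field of rational functions. -/
def Seed.toFieldSeed (s : Seed V) : FieldSeed V (RatFun V) := ⟨s.quiver, s.cluster⟩

/-- A seed with values in the field of rational functions as a seed. -/
def FieldSeed.toSeed (s : FieldSeed V (RatFun V)) : Seed V := ⟨s.quiver, s.cluster⟩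

variable [Fintype V] [DecidableEq V]

theorem Seed.MutEquiv.toFieldSeed {s t : Seed V} (h : s.MutEquiv t) :
    s.toFieldSeed.MutEquiv t.toFieldSeed := by
  induction h with
  | refl => exact Relation.ReflTransGen.refl
  | tail _ h ih =>
    obtain ⟨k, hk, rfl⟩ := h
    exact ih.tail ⟨k, hk, rfl⟩

theorem FieldSeed.MutEquiv.toSeed {s t : FieldSeed V (RatFun V)} (h : s.MutEquiv t) :
    s.toSeed.MutEquiv t.toSeed := by
  induction h with
  | refl => exact Relation.ReflTransGen.refl
  | tail _ h ih =>
    obtain ⟨k, hk, rfl⟩ := h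
    exact ih.tail ⟨k, hk, rfl⟩

theorem Seed.IsAcyclic.toFieldSeed {s : Seed V} (h : s.IsAcyclic) : s.toFieldSeed.IsAcyclic := by
  obtain ⟨t, ht, h⟩ := h
  exact ⟨t.toFieldSeed, ht.toFieldSeed, h⟩

omit [Fintype V] [DecidableEq V] in
/-- The subring generated by a set does not depend on the instance of `Algebra ℤ (RatFun V)`, which
may come from the localization or from the ring structure. -/
theorem mem_adjoin_int_iff {S : Set (RatFun V)} {x : RatFun V} :
    x ∈ Algebra.adjoin ℤ S ↔
      x ∈ @Algebra.adjoin ℤ (RatFun V) _ _ (Ring.toIntAlgebra (RatFun V)) S := by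
  have h := Subsingleton.elim (Ring.toIntAlgebra (RatFun V)) OreLocalization.instAlgebra
  rw [h]

theorem Seed.mem_clusterAlgebra_iff {s : Seed V} {x : RatFun V} :
    x ∈ s.clusterAlgebra ↔ x ∈ s.toFieldSeed.clusterAlgebra := by
  have h : s.clusterVariables
      = {x | ∃ t, s.toFieldSeed.MutEquiv t ∧ ∃ v, x = t.cluster v} := by
    ext x
    constructor
    · rintro ⟨t, ht, v, rfl⟩
      exact ⟨t.toFieldSeed, ht.toFieldSeed, v, rfl⟩
    · rintro ⟨t, ht, v, rfl⟩
      exact ⟨t.toSeed, ht.toSeed, v, rfl⟩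
  rw [Seed.clusterAlgebra, h]
  exact mem_adjoin_int_iff

omit [Fintype V] [DecidableEq V] in
theorem Seed.mem_laurentRing_iff {s : Seed V} {x : RatFun V} :
    x ∈ s.laurentRing ↔ x ∈ laurentOn s.cluster Set.univ := by
  rw [Seed.laurentRing, laurentOn, Set.image_univ, Set.image_univ]
  exact mem_adjoin_int_iff

theorem Seed.mem_upperClusterAlgebra_iff {s : Seed V} {x : RatFun V} :
    x ∈ s.upperClusterAlgebra ↔ x ∈ s.toFieldSeed.upperClusterAlgebra := by
  simp only [Seed.upperClusterAlgebra, FieldSeed.upperClusterAlgebra, Algebra.mem_iInf,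
    Seed.mem_laurentRing_iff]
  exact ⟨fun h t ht => h t.toSeed ht.toSeed, fun h t ht => h t.toFieldSeed ht.toFieldSeed⟩

omit [Fintype V] [DecidableEq V] in
/-- Passage to the `ℚ`-algebra structure of `RatFun V` that is derived from its field structure. -/
theorem Seed.algebraicIndependent_toFieldSeed {s : Seed V}
    (hs : AlgebraicIndependent ℚ s.cluster) :
    @AlgebraicIndependent V ℚ (RatFun V) s.toFieldSeed.cluster _
      (FractionRing.field (MvPolynomial V ℚ)).toCommRing
      (@DivisionRing.toRatAlgebra _ (FractionRing.field (MvPolynomial V ℚ)).toDivisionRing _) :=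
  algebraicIndependent_rat_congr _ _ hs

end Comparison

end ClusterAlg

theorem theorem4p1 {V : Type*} [Fintype V] [DecidableEq V] (s : ClusterAlg.Seed V)
    (hs : AlgebraicIndependent ℚ s.cluster) (hA : s.IsLocallyAcyclic) :
    s.clusterAlgebra = s.upperClusterAlgebra := by
  have hs' := ClusterAlg.Seed.algebraicIndependent_toFieldSeed hs
  ext u
  refine ⟨fun hu => ?_, fun hu => ?_⟩
  · rw [ClusterAlg.Seed.mem_clusterAlgebra_iff] at hu
    rw [ClusterAlg.Seed.mem_upperClusterAlgebra_iff]
    exact ClusterAlg.FieldSeed.clusterAlgebra_le_upperClusterAlgebra hs' hu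
  · rw [ClusterAlg.Seed.mem_upperClusterAlgebra_iff] at hu
    obtain ⟨C, -, hC, hcover⟩ := hA
    refine ClusterAlg.mem_of_forall_primeSpectrum _ fun P => ?_
    obtain ⟨U, hU, hPU⟩ := Set.mem_sUnion.mp (hcover ▸ Set.mem_univ P)
    obtain ⟨t, F, ht, -, hF, hle, rfl⟩ := hC U hU
    obtain ⟨y, hy, hy0, hy', hyu⟩ := ClusterAlg.FieldSeed.exists_mul_mem_of_isAcyclic_freeze
      (s := s.toFieldSeed) (t := t.toFieldSeed) (F := F) hs' ht.toFieldSeed hF.toFieldSeed hu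
    exact ⟨⟨y, ClusterAlg.Seed.mem_clusterAlgebra_iff.mpr hy⟩,
      ClusterAlg.notMem_of_mem_range_comap hle hPU _
        (ClusterAlg.Seed.mem_clusterAlgebra_iff.mpr hy') (inv_mul_cancel₀ hy0),
      ClusterAlg.Seed.mem_clusterAlgebra_iff.mpr hyu⟩
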